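/- **Setting (non-preemptive machine replenishment).** There are $n$ machines and a repair capacity $M\ge 1$. Machine $i$ has a finite set $S_i$ of active states, a transition matrix $(p_{uv})_{u,v\in S_i}$, rewards $r_u\ge 0$ and repair costs $c_u\ge 0$ $(u\in S_i)$, a repair success probability $s_i\in(0,1]$ and an initial active state $\rho_i\in S_i$. At the beginning of each time slot the scheduler, who sees all states, may move any active machines to the repair queue, paying $c_u$ for a machine in state $u$; then it chooses at most $M$ machines in the repair queue (machines just moved there included) to be worked on in this slot. A machine leaves the queue only when its repair is complete, and a repair that has been started must be worked on in every slot until it is complete. A machine that is worked on completes its repair at the end of the slot with probability $s_i$ and is then in state $\rho_i$ at the beginning of the next slot. An active machine in state $u$ that is not moved yields reward $r_u$ in the slot and moves to $v\in S_i$ with probability $p_{uv}$; machines in the queue yield no reward. All these random events are independent. Let $R_t$ be the expected total reward minus cost in slot $t$, and let $OPT$ be the supremum of $\limsup_T \frac1T\sum_{t<T}R_t$ over all history-dependent, possibly randomized scheduling policies and all active start states. **Balanced programs.** The balanced dual program in the variables $\lambda$, $h_i$, $\phi_u$ is $$\begin{array}{lll}\text{minimize } M\lambda+\sum_i h_i \text{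 subject to}\quad & \lambda+h_i\ge s_i\phi_{\rho_i} & \forall i,\\ & h_i\ge r_u+\sum_{v\in S_i}p_{uv}(\phi_v-\phi_u) & \forall i,\,u\in S_i,\\ & \phi_u+c_u\ge 0 & \forall i,\,u\in S_i,\\ & M\lambda=\sum_i h_i,\quad \lambda,h_i\ge 0 .\end{array}$$ Its linear programming dual, the balanced primal program, in the variables $x_u,z_u,x_{\kappa_i}\ge 0$ and $\omega\in\mathbb R$, is $$\begin{array}{lll}\text{maximize } \sum_i\sum_{u\in S_i}(r_ux_u-c_uz_u) \text{ subject to}\quad & \sum_i x_{\kappa_i}\le M(1+\omega), & \\ & x_{\kappa_i}+\sum_{u\in S_i}x_u\le 1-\omega & \forall i,\\ & [u=\rho_i]\,s_ix_{\kappa_i}+\sum_{v\ne u}x_vp_{vu}=z_u+\sum_{v\neq u}x_up_{uv} & \forall i,\,u\in S_i.\end{array}$$ **Balanced policy.** Given optimal solutions $(\lambda,h,\phi)$ and $(x,x_\kappa,z,\omega)$ of the two programs: at the beginning of each slot, move a machine $i$ to the repair queue exactly when $h_i>0$ and it is in an active state $u$ with $z_u>0$. Then, if $S_r$ is the set of machines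 in the queue, work on some $\min(M,|S_r|)$ of them, non-preemptively and otherwise chosen arbitrarily. **Theorem.** Both balanced programs have optimal solutions. For all optimal solutions of the two, let each machine start in an active state such that every machine $i$ with $h_i>0$ either starts in a state $u$ with $x_u+z_u>0$, or starts in $\rho_i$ and the Markov chain $(p_{uv})_{u,v\in S_i}$ has a single recurrent class. Such start states exist; for any of them balanced policies exist, and every balanced policy is a valid scheduling policy that is a $2$-approximation: $$\liminf_{T\to\infty}\frac1T\sum_{t<T}R_t\ \ge\ \tfrac12\,OPT .$$ -/

import Mathlib

open Finset Filter
open scoped NNReal ENNReal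

universe u

namespace Replenishment

/-- An instance of non-preemptive machine replenishment with `n` machines; `S i` is the set of
active states of machine `i`. -/
structure Model (n : ℕ) (S : Fin n → Type u) where
  /-- `p i u` is the distribution of the next state of an active machine `i` in state `u`. -/
  p : ∀ i, S i → PMF (S i)
  /-- reward per time slot in an active state -/
  r : ∀ i, S i → ℝ
  r_nonneg : ∀ i u, 0 ≤ r i u
  /-- cost of moving the machine from an active state to the repair queue -/
  c : ∀ i, S i → ℝ
  c_nonneg : ∀ i u, 0 ≤ c i u
  /-- probability that a repair completes in a slot in which it is being worked on -/
  s : Fin n → ℝ≥0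
  s_pos : ∀ i, 0 < s i
  s_le_one : ∀ i, s i ≤ 1
  /-- the state in which a machine leaves the repair -/
  ρ : ∀ i, S i
  /-- number of machines that can be under repair at the same time -/
  M : ℕ
  M_pos : 0 < M

/-- The status of a machine: active in a state, waiting in the repair queue (its repair has not
been started), or in the repair queue with its repair started and not yet completed. -/
inductive Status (A : Type u) : Type u
  | active (u : A)
  | queued
  | inRepair

/-- The three kinds of status as a sum type, used only to count them. -/
def Status.equivSum (A : Type u) : A ⊕ Bool ≃ Status A where
  toFun x := match x with
    | .inl u => .active u
    | .inr true => .queued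
    | .inr false => .inRepair
  invFun x := match x with
    | .active u => .inl u
    | .queued => .inr true
    | .inRepair => .inr false
  left_inv := by rintro (u | _ | _) <;> rfl
  right_inv := by rintro (u | _ | _) <;> rfl

instance (A : Type u) [Fintype A] : Fintype (Status A) := Fintype.ofEquiv _ (Status.equivSum A)

/-- The joint status of all machines at the beginning of a slot. -/
abbrev Config {n : ℕ} (S : Fin n → Type u) : Type u := ∀ i, Status (S i)

/-- The decision in a slot: the active machines that are moved to the repair queue (at the
beginning of the slot), and the machines in the queue that are worked on during the slot. -/
abbrev Decision (n : ℕ) : Type := Finset (Fin n) × Finset (Fin n)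

abbrev Decision.move {n : ℕ} (a : Decision n) : Finset (Fin n) := a.1

abbrev Decision.serve {n : ℕ} (a : Decision n) : Finset (Fin n) := a.2

/-- What has been observed up to the beginning of slot `t`: the initial configuration, and for
each earlier slot the decision taken and the configuration it led to. -/
def History {n : ℕ} (S : Fin n → Type u) : ℕ → Type u
  | 0 => Config S
  | t + 1 => History S t × Decision n × Config S

instance History.instFintype {n : ℕ} (S : Fin n → Type u) [∀ i, Fintype (S i)] :
    ∀ t, Fintype (History S t)
  | 0 => inferInstanceAs (Fintype (Config S))
  | t + 1 =>
    letI := History.instFintype S t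
    inferInstanceAs (Fintype (History S t × Decision n × Config S))

/-- The configuration at the beginning of slot `t`. -/
def History.current {n : ℕ} {S : Fin n → Type u} : {t : ℕ} → History S t → Config S
  | 0, h => h
  | _ + 1, h => h.2.2

/-- A scheduling policy: a randomized decision for every history. -/
abbrev Policy {n : ℕ} (S : Fin n → Type u) : Type u := ∀ t, History S t → PMF (Decision n)

/-- The law of independent random variables with laws `q i`. -/
noncomputable def independent {n : ℕ} {A : Fin n → Type u} [∀ i, Fintype (A i)]
    (q : ∀ i, PMF (A i)) : PMF (∀ i, A i) :=
  PMF.ofFintype (fun a => ∏ i, q i (a i)) (by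
    have h := Finset.prod_univ_sum (fun i => (Finset.univ : Finset (A i))) (fun i a => q i a)
    rw [Fintype.piFinset_univ] at h
    rw [← h]
    refine Finset.prod_eq_one fun i _ => ?_
    rw [← tsum_fintype (L := .unconditional _)]
    exact (q i).tsum_coe)

/-- `true` with probability `s`. -/
noncomputable def coin (s : ℝ≥0) (hs : s ≤ 1) : PMF Bool :=
  PMF.ofFintype (fun b => if b then (s : ℝ≥0∞) else 1 - (s : ℝ≥0∞)) (by
    have : (s : ℝ≥0∞) ≤ 1 := by exact_mod_cast hs
    simp [this])

namespace Model

variable {n : ℕ} {S : Fin n → Type u} (I : Model n S)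

/-- The distribution of the status of machine `i` at the beginning of the next slot. -/
noncomputable def machineStep (a : Decision n) (i : Fin n) (σ : Status (S i)) :
    PMF (Status (S i)) :=
  if i ∈ a.serve then
    (coin (I.s i) (I.s_le_one i)).map fun done => if done then .active (I.ρ i) else .inRepair
  else match σ with
    | .active u => if i ∈ a.move then PMF.pure .queued else (I.p i u).map .active
    | .queued => PMF.pure .queued
    | .inRepair => PMF.pure .inRepair

/-- Reward minus cost of machine `i` in the current slot. -/
noncomputable def machineReward (a : Decision n) (i : Fin n) (σ : Status (S i)) : ℝ :=
  match σ with
  | .active u => if i ∈ a.move then -I.c i u else I.r i u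
  | .queued => 0
  | .inRepair => 0

/-- Reward minus cost of all machines in the current slot. -/
noncomputable def reward (σ : Config S) (a : Decision n) : ℝ :=
  ∑ i, I.machineReward a i (σ i)

/-- Machine `i` is in the repair queue after the moves of the current slot. -/
def InQueue (σ : Config S) (a : Decision n) (i : Fin n) : Prop :=
  i ∈ a.move ∨ σ i = .queued ∨ σ i = .inRepair

/-- The constraints on a decision: only active machines are moved to the queue, only machines in
the queue are worked on, repairs that have been started are not interrupted, and at most `M`
machines are worked on. -/
structure Feasible (σ : Config S) (a : Decision n) : Prop where
  move_active : ∀ i ∈ a.move, ∃ u, σ i = .active u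
  serve_inQueue : ∀ i ∈ a.serve, InQueue σ a i
  nonpreemptive : ∀ i, σ i = .inRepair → i ∈ a.serve
  capacity : a.serve.card ≤ I.M

section Dynamics

variable [∀ i, Fintype (S i)]

/-- The law of the next configuration; the machines evolve independently. -/
noncomputable def step (σ : Config S) (a : Decision n) : PMF (Config S) :=
  independent fun i => I.machineStep a i (σ i)

/-- The law of the history up to slot `t` when machine `i` starts in the active state `σ₀ i`. -/
noncomputable def law (σ₀ : ∀ i, S i) (π : Policy S) : (t : ℕ) → PMF (History S t)
  | 0 => PMF.pure (fun i => Status.active (σ₀ i) : Config S)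
  | t + 1 => (law σ₀ π t).bind fun h => (π t h).bind fun a =>
      (I.step h.current a).map fun σ => (h, a, σ)

/-- The policy takes only feasible decisions, almost surely. -/
def Admissible (σ₀ : ∀ i, S i) (π : Policy S) : Prop :=
  ∀ t, ∀ h ∈ (I.law σ₀ π t).support, ∀ a ∈ (π t h).support, I.Feasible h.current a

/-- Expected reward minus cost in slot `t`. -/
noncomputable def expectedReward (σ₀ : ∀ i, S i) (π : Policy S) (t : ℕ) : ℝ :=
  ∑ h : History S t, (I.law σ₀ π t h).toReal *
    ∑ a : Decision n, (π t h a).toReal * I.reward h.current a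

/-- Expected time average of reward minus cost over the first `T` slots. -/
noncomputable def average (σ₀ : ∀ i, S i) (π : Policy S) (T : ℕ) : ℝ :=
  (∑ t ∈ range T, I.expectedReward σ₀ π t) / T

/-- The optimal long-run time average of reward minus cost, over all admissible policies and all
start states (evaluated through the limit superior). -/
noncomputable def optimalValue : EReal :=
  ⨆ (σ₀ : ∀ i, S i) (π : Policy S) (_ : I.Admissible σ₀ π),
    limsup (fun T => (I.average σ₀ π T : EReal)) atTop

/-- The guaranteed long-run time average of a policy (evaluated through the limit inferior). -/
noncomputable def guaranteedValue (σ₀ : ∀ i, S i) (π : Policy S) : EReal :=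
  liminf (fun T => (I.average σ₀ π T : EReal)) atTop

end Dynamics

/-- One-step transition probability as a real number. -/
noncomputable def prob (i : Fin n) (u v : S i) : ℝ := (I.p i u v).toReal

/-- The active chain of machine `i` has a single recurrent class: some state is reachable from
every state. -/
def Unichain (i : Fin n) : Prop :=
  ∃ w, ∀ u, Relation.ReflTransGen (fun a b => 0 < I.prob i a b) u w

end Model

/-- Variables of the balanced dual program. -/
structure DualVars {n : ℕ} (S : Fin n → Type u) where
  lam : ℝ
  h : Fin n → ℝ
  phi : ∀ i, S i → ℝ

/-- Variables of the balanced primal program (the linear programming dual of the balanced dual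
program): `x i u` and `z i u` for active states `u`, `xκ i` for the state of being repaired, and
`ω` for the multiplier of the balance constraint. -/
structure PrimalVars {n : ℕ} (S : Fin n → Type u) where
  x : ∀ i, S i → ℝ
  xκ : Fin n → ℝ
  z : ∀ i, S i → ℝ
  ω : ℝ

namespace Model

variable {n : ℕ} {S : Fin n → Type u} [∀ i, Fintype (S i)] (I : Model n S)

noncomputable def dualObjective (D : DualVars S) : ℝ := I.M * D.lam + ∑ i, D.h i

structure DualFeasible (D : DualVars S) : Prop where
  repair : ∀ i, D.lam + D.h i ≥ I.s i * D.phi i (I.ρ i)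
  active : ∀ i u, D.h i ≥ I.r i u + ∑ v, I.prob i u v * (D.phi i v - D.phi i u)
  move : ∀ i u, D.phi i u + I.c i u ≥ 0
  balance : I.M * D.lam = ∑ i, D.h i
  lam_nonneg : 0 ≤ D.lam
  h_nonneg : ∀ i, 0 ≤ D.h i

/-- Optimal solution of the balanced dual (a minimization problem). -/
def DualOptimal (D : DualVars S) : Prop :=
  I.DualFeasible D ∧ ∀ D', I.DualFeasible D' → I.dualObjective D ≤ I.dualObjective D'

noncomputable def primalObjective (P : PrimalVars S) : ℝ :=
  ∑ i, ∑ u, (I.r i u * P.x i u - I.c i u * P.z i u)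

structure PrimalFeasible [∀ i, DecidableEq (S i)] (P : PrimalVars S) : Prop where
  capacity : ∑ i, P.xκ i ≤ I.M * (1 + P.ω)
  mass : ∀ i, P.xκ i + ∑ u, P.x i u ≤ 1 - P.ω
  flow : ∀ i u, (if u = I.ρ i then I.s i * P.xκ i else 0)
      + ∑ v ∈ univ.erase u, P.x i v * I.prob i v u
    = P.z i u + ∑ v ∈ univ.erase u, P.x i u * I.prob i u v
  x_nonneg : ∀ i u, 0 ≤ P.x i u
  xκ_nonneg : ∀ i, 0 ≤ P.xκ i
  z_nonneg : ∀ i u, 0 ≤ P.z i u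

/-- Optimal solution of the balanced primal (a maximization problem). -/
def PrimalOptimal [∀ i, DecidableEq (S i)] (P : PrimalVars S) : Prop :=
  I.PrimalFeasible P ∧ ∀ P', I.PrimalFeasible P' → I.primalObjective P' ≤ I.primalObjective P

/-- Start states covered by the guarantee: every machine `i` with `h i > 0` starts in a state
charged by the primal solution, or it starts in `ρ i` and its active chain has a single recurrent
class. -/
def GoodStart (D : DualVars S) (P : PrimalVars S) (σ₀ : ∀ i, S i) : Prop :=
  ∀ i, 0 < D.h i →
    0 < P.x i (σ₀ i) + P.z i (σ₀ i) ∨ (σ₀ i = I.ρ i ∧ I.Unichain i)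

/-- The balanced decision rule: machine `i` is moved to the repair queue exactly when `h i > 0` and
it is in an active state `u` with `z i u > 0`; as many machines in the queue as the capacity allows
are worked on, and these are otherwise arbitrary. -/
structure BalancedDecision (D : DualVars S) (P : PrimalVars S) (σ : Config S) (a : Decision n) :
    Prop where
  feasible : I.Feasible σ a
  move_iff : ∀ i, i ∈ a.move ↔ 0 < D.h i ∧ ∃ u, σ i = .active u ∧ 0 < P.z i u
  busy : a.serve.card = min I.M {i | InQueue σ a i}.ncard

/-- The policy started from `σ₀` follows the balanced decision rule, almost surely. -/
def IsBalancedPolicy (D : DualVars S) (P : PrimalVars S) (σ₀ : ∀ i, S i) (π : Policy S) : Prop :=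
  ∀ t, ∀ h ∈ (I.law σ₀ π t).support, ∀ a ∈ (π t h).support,
    I.BalancedDecision D P h.current a

end Model

end Replenishment

/-! The dual solution is used as a potential: `D.phi` on active states and zero in the queue. For a
dual feasible point and a feasible decision, reward plus expected change of potential is at most `h
i` for each machine, plus `lam` for each machine worked on. The potential is bounded and its changes
telescope, so no admissible policy earns more than `M * lam + ∑ i, h i` per slot in the long run
(`reward_add_expect_le`, `optimalValue_le`).

For a balanced policy the inequalities are needed in the other direction. With a suitable potential,
an active machine that is not moved contributes at least `h i`, a machine worked on at least `lam +
h i`, and a waiting machine at least zero. Either `M` machines are worked on, for a total of at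
least `M * lam`, or nobody waits, for a total of at least `∑ i, h i`. By the balance constraint both
numbers are half of the dual objective (`BalancedDecision.le_reward_add_expect`).

The suitable potential comes from `exists_certificate`. If `h i = 0`, zero works. If machine `i`
with `h i > 0` starts in a state charged by the primal solution, complementary slackness makes the
dual constraints tight on charged states, and the flow equations keep the machine among them. If it
starts in an uncharged `ρ i`, it is never repaired; the constraints are then tight only on the
support of `x`, and a large multiple of a function with positive drift outside the support repairs
`D.phi` elsewhere (`exists_drift_of_reachable`). Complementary slackness rests on strong duality,
derived from Farkas' lemma. -/

namespace Replenishment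

/-! ### Linear programming duality -/

/-- **Farkas' lemma** for finitely many linear functionals. -/
theorem exists_nonneg_combination_of_nonneg {ι V : Type*} [AddCommGroup V] [Module ℝ V]
    (s : Finset ι) : ∀ (f : ι → V →ₗ[ℝ] ℝ) (g : V →ₗ[ℝ] ℝ),
      (∀ v, (∀ j ∈ s, 0 ≤ f j v) → 0 ≤ g v) →
      ∃ c : ι → ℝ, (∀ j, 0 ≤ c j) ∧ ∀ v, g v = ∑ j ∈ s, c j * f j v := by
  classical
  induction s using Finset.induction_on with
  | empty =>
    intro f g hg
    refine ⟨0, fun _ => le_rfl, fun v => ?_⟩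
    have h1 := hg v (by simp)
    have h2 := hg (-v) (by simp)
    rw [map_neg] at h2
    simp only [sum_empty]
    linarith
  | insert a s ha ih =>
    intro f g hg
    by_cases h : ∀ v, (∀ j ∈ s, 0 ≤ f j v) → 0 ≤ g v
    · obtain ⟨c, hc, hgc⟩ := ih f g h
      refine ⟨Function.update c a 0, fun j => ?_, fun v => ?_⟩
      · by_cases hj : j = a
        · simp [hj]
        · simpa [hj] using hc j
      · rw [sum_insert ha, hgc v]
        simp only [Function.update_self, zero_mul, zero_add]
        refine sum_congr rfl fun j hj => ?_
        rw [Function.update_of_ne (ne_of_mem_of_not_mem hj ha)]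
    · push Not at h
      obtain ⟨v, hv, hgv⟩ := h
      have hav : f a v < 0 := by
        by_contra hcon
        push Not at hcon
        refine absurd (hg v fun j hj => ?_) (not_le.2 hgv)
        rcases mem_insert.1 hj with rfl | hj
        exacts [hcon, hv j hj]
      -- These functionals are the old ones composed with the projection along `v` onto the kernel
      -- of `f a`, where the constraint `a` holds trivially.
      obtain ⟨c, hc, hgc⟩ := ih (fun j => f j - (f j v / f a v) • f a)
        (g - (g v / f a v) • f a) (by
          intro w hw
          have key := hg (w - (f a w / f a v) • v) (by
            intro j hj
            rcases mem_insert.1 hj with rfl | hj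
            · simp [hav.ne]
            · have := hw j hj
              simp only [LinearMap.sub_apply, LinearMap.smul_apply, smul_eq_mul, map_sub,
                map_smul] at this ⊢
              convert this using 2
              ring)
          simp only [LinearMap.sub_apply, LinearMap.smul_apply, smul_eq_mul, map_sub,
            map_smul] at key ⊢
          convert key using 2
          ring)
      -- The coefficient of `f a` once the projected identity is expanded. It is nonnegative because
      -- `g v < 0 ≤ f j v` for `j ∈ s`, while `f a v < 0`.
      set d : ℝ := (g v - ∑ j ∈ s, c j * f j v) / f a v with hd
      have hd0 : 0 ≤ d := by
        refine div_nonneg_of_nonpos ?_ hav.le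
        have : 0 ≤ ∑ j ∈ s, c j * f j v := sum_nonneg fun j hj => mul_nonneg (hc j) (hv j hj)
        linarith
      refine ⟨Function.update c a d, fun j => ?_, fun w => ?_⟩
      · by_cases hj : j = a
        · subst hj; simpa using hd0
        · simpa [hj] using hc j
      · have h1 := hgc w
        simp only [LinearMap.sub_apply, LinearMap.smul_apply, smul_eq_mul, mul_sub,
          sum_sub_distrib] at h1
        have h2 : ∑ j ∈ s, c j * (f j v / f a v * f a w)
            = (∑ j ∈ s, c j * f j v) / f a v * f a w := by
          rw [sum_div, sum_mul]
          exact sum_congr rfl fun j _ => by ring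
        have h3 : ∑ j ∈ s, Function.update c a d j * f j w = ∑ j ∈ s, c j * f j w :=
          sum_congr rfl fun j hj => by
            rw [Function.update_of_ne (ne_of_mem_of_not_mem hj ha)]
        rw [sum_insert ha, Function.update_self, h3, hd, sub_div, sub_mul]
        linarith

/-- A bound on a feasible linear program is certified by a dual solution. -/
theorem exists_dual_le_of_bound {J K : Type*} [Fintype J] [Fintype K] (A : J → K → ℝ)
    (b : J → ℝ) (c : K → ℝ) (β : ℝ)
    (hfeas : ∃ x : K → ℝ, (∀ k, 0 ≤ x k) ∧ ∀ j, ∑ k, A j k * x k ≤ b j)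
    (hbound : ∀ x : K → ℝ, (∀ k, 0 ≤ x k) → (∀ j, ∑ k, A j k * x k ≤ b j) →
      ∑ k, c k * x k ≤ β) :
    ∃ y : J → ℝ, (∀ j, 0 ≤ y j) ∧ (∀ k, c k ≤ ∑ j, A j k * y j) ∧ ∑ j, b j * y j ≤ β := by
  classical
  let dot (a : K → ℝ) : (K → ℝ) × ℝ →ₗ[ℝ] ℝ :=
    (∑ k, a k • LinearMap.proj k) ∘ₗ LinearMap.fst ℝ (K → ℝ) ℝ
  have dot_apply (a : K → ℝ) (v : (K → ℝ) × ℝ) : dot a v = ∑ k, a k * v.1 k := by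
    simp [dot]
  let t : (K → ℝ) × ℝ →ₗ[ℝ] ℝ := LinearMap.snd ℝ (K → ℝ) ℝ
  -- Homogenization: the extra coordinate `t` scales the right-hand sides, so that Farkas' lemma for
  -- cones applies.
  let f : J ⊕ K ⊕ Unit → (K → ℝ) × ℝ →ₗ[ℝ] ℝ
    | .inl j => b j • t - dot (A j)
    | .inr (.inl k) => LinearMap.proj k ∘ₗ LinearMap.fst ℝ (K → ℝ) ℝ
    | .inr (.inr _) => t
  obtain ⟨x₀, hx₀, hA₀⟩ := hfeas
  obtain ⟨w, hw, hgw⟩ := exists_nonneg_combination_of_nonneg univ f (β • t - dot c) (by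
    rintro ⟨x, τ⟩ hv
    have hA : ∀ j, ∑ k, A j k * x k ≤ b j * τ := fun j => by
      have := hv (.inl j) (mem_univ _)
      simp only [f, t, LinearMap.sub_apply, LinearMap.smul_apply, LinearMap.snd_apply,
        dot_apply, smul_eq_mul] at this
      linarith
    have hx : ∀ k, 0 ≤ x k := fun k => by
      simpa [f] using hv (.inr (.inl k)) (mem_univ _)
    have hτ : 0 ≤ τ := by simpa [f, t] using hv (.inr (.inr ())) (mem_univ _)
    simp only [t, LinearMap.sub_apply, LinearMap.smul_apply, LinearMap.snd_apply,
      dot_apply, smul_eq_mul, sub_nonneg]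
    -- At `τ = 0` the point is a recession direction and must not increase the objective; at `τ > 0`
    -- dividing by `τ` gives a feasible point.
    rcases hτ.eq_or_lt with hτ | hτ
    · subst hτ
      simp only [mul_zero] at hA ⊢
      by_contra hpos
      push Not at hpos
      set δ := ∑ k, c k * x k with hδ
      -- Far enough along the direction for the objective to reach at least `β + 1`.
      set r : ℝ := max 0 ((β - ∑ k, c k * x₀ k + 1) / δ) with hr
      have hr0 : 0 ≤ r := le_max_left _ _
      have h1 := hbound (fun k => x₀ k + r * x k)
        (fun k => add_nonneg (hx₀ k) (mul_nonneg hr0 (hx k))) (fun j => by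
          have : ∑ k, A j k * (x₀ k + r * x k)
              = ∑ k, A j k * x₀ k + r * ∑ k, A j k * x k := by
            rw [mul_sum, ← sum_add_distrib]
            exact sum_congr rfl fun k _ => by ring
          rw [this]
          have := mul_nonpos_of_nonneg_of_nonpos hr0 (hA j)
          linarith [hA₀ j])
      have h2 : ∑ k, c k * (x₀ k + r * x k) = ∑ k, c k * x₀ k + r * δ := by
        rw [hδ, mul_sum, ← sum_add_distrib]
        exact sum_congr rfl fun k _ => by ring
      have h3 : (β - ∑ k, c k * x₀ k + 1) ≤ r * δ := by
        rw [← div_le_iff₀ hpos]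
        exact le_max_right _ _
      linarith
    · have h1 := hbound (fun k => x k / τ) (fun k => div_nonneg (hx k) hτ.le) (fun j => by
        simp only [mul_div_assoc', ← sum_div]
        exact (div_le_iff₀ hτ).2 (hA j))
      simp only [mul_div_assoc', ← sum_div] at h1
      exact (div_le_iff₀ hτ).1 h1)
  refine ⟨fun j => w (.inl j), fun j => hw _, fun k => ?_, ?_⟩
  -- The multipliers of the rows form the dual solution: unit vectors give its constraints, the
  -- homogenizing direction gives its value.
  · have h := hgw (Pi.single k 1, 0)
    simp only [Fintype.sum_sum_type, f, t, LinearMap.sub_apply, LinearMap.smul_apply, dot_apply,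
      LinearMap.snd_apply, LinearMap.comp_apply, LinearMap.fst_apply, LinearMap.proj_apply,
      smul_eq_mul, Pi.single_apply, mul_ite, mul_one, mul_zero, sum_ite_eq', mem_univ, if_true,
      zero_sub, mul_neg, sum_neg_distrib, sum_const_zero, add_zero] at h
    have := hw (.inr (.inl k))
    simp only [mul_comm (A _ k)]
    linarith
  · have h := hgw (0, 1)
    simp only [Fintype.sum_sum_type, f, t, LinearMap.sub_apply, LinearMap.smul_apply, dot_apply,
      LinearMap.snd_apply, LinearMap.comp_apply, LinearMap.fst_apply, LinearMap.proj_apply,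
      smul_eq_mul, Pi.zero_apply, mul_zero, mul_one, sum_const_zero, sub_zero, zero_add,
      univ_unique, sum_singleton] at h
    have := hw (.inr (.inr ()))
    have h2 : ∑ j, b j * w (.inl j) = ∑ j, w (.inl j) * b j :=
      sum_congr rfl fun j _ => mul_comm _ _
    rw [h2]
    change _ = _ + w (.inr (.inr ())) at h
    linarith

/-- **Strong duality**: if a linear program and its dual are feasible, they have feasible
solutions with the same value. -/
theorem exists_primal_dual_of_feasible {J K : Type*} [Fintype J] [Fintype K] (A : J → K → ℝ)
    (b : J → ℝ) (c : K → ℝ)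
    (hP : ∃ x : K → ℝ, (∀ k, 0 ≤ x k) ∧ ∀ j, ∑ k, A j k * x k ≤ b j)
    (hD : ∃ y : J → ℝ, (∀ j, 0 ≤ y j) ∧ ∀ k, c k ≤ ∑ j, A j k * y j) :
    ∃ (x : K → ℝ) (y : J → ℝ), (∀ k, 0 ≤ x k) ∧ (∀ j, ∑ k, A j k * x k ≤ b j) ∧
      (∀ j, 0 ≤ y j) ∧ (∀ k, c k ≤ ∑ j, A j k * y j) ∧
      ∑ j, b j * y j ≤ ∑ k, c k * x k := by
  have weak : ∀ (x : K → ℝ) (y : J → ℝ), (∀ k, 0 ≤ x k) → (∀ j, ∑ k, A j k * x k ≤ b j) →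
      (∀ j, 0 ≤ y j) → (∀ k, c k ≤ ∑ j, A j k * y j) →
      ∑ k, c k * x k ≤ ∑ j, b j * y j := by
    intro x y hx hAx hy hAy
    calc ∑ k, c k * x k ≤ ∑ k, (∑ j, A j k * y j) * x k :=
          sum_le_sum fun k _ => mul_le_mul_of_nonneg_right (hAy k) (hx k)
      _ = ∑ j, (∑ k, A j k * x k) * y j := by
          simp only [sum_mul]
          rw [sum_comm]
          exact sum_congr rfl fun j _ => sum_congr rfl fun k _ => by ring
      _ ≤ ∑ j, b j * y j := sum_le_sum fun j _ => mul_le_mul_of_nonneg_right (hAx j) (hy j)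
  let V : Set ℝ := {r | ∃ x : K → ℝ, (∀ k, 0 ≤ x k) ∧ (∀ j, ∑ k, A j k * x k ≤ b j) ∧
    r = ∑ k, c k * x k}
  obtain ⟨x₀, hx₀, hA₀⟩ := hP
  obtain ⟨y₀, hy₀, hB₀⟩ := hD
  have hne : V.Nonempty := ⟨_, x₀, hx₀, hA₀, rfl⟩
  have hbdd : BddAbove V := ⟨∑ j, b j * y₀ j, by
    rintro _ ⟨x, hx, hA, rfl⟩
    exact weak x y₀ hx hA hy₀ hB₀⟩
  obtain ⟨y, hy, hB, hyβ⟩ := exists_dual_le_of_bound A b c (sSup V) ⟨x₀, hx₀, hA₀⟩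
    fun x hx hA => le_csSup hbdd ⟨x, hx, hA, rfl⟩
  -- The same lemma for the negated dual program: its certificate is a primal point that attains the
  -- supremum, so no compactness argument is needed.
  obtain ⟨x, hx, hA, hxβ⟩ := exists_dual_le_of_bound (fun k j => -A j k) (fun k => -c k)
    (fun j => -b j) (-sSup V) ⟨y₀, hy₀, fun k => by
      simp only [neg_mul, sum_neg_distrib, neg_le_neg_iff]; exact hB₀ k⟩ (by
      intro y hy hB
      simp only [neg_mul, sum_neg_distrib, neg_le_neg_iff] at hB ⊢
      refine csSup_le hne ?_
      rintro _ ⟨x, hx, hA, rfl⟩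
      exact weak x y hx hA hy hB)
  simp only [neg_mul, sum_neg_distrib, neg_le_neg_iff] at hA hxβ
  exact ⟨x, y, hx, hA, hy, hB, hyβ.trans hxβ⟩

/-! ### The balanced programs -/

namespace Model

variable {n : ℕ} {S : Fin n → Type u} (I : Model n S)

theorem prob_nonneg (i : Fin n) (u v : S i) : 0 ≤ I.prob i u v := ENNReal.toReal_nonneg

variable [∀ i, Fintype (S i)]

theorem sum_prob (i : Fin n) (u : S i) : ∑ v, I.prob i u v = 1 := by
  have h := (I.p i u).tsum_coe
  rw [tsum_fintype] at h
  unfold prob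
  rw [← ENNReal.toReal_sum fun v _ => (I.p i u).apply_ne_top v, h, ENNReal.toReal_one]

theorem sum_prob_mul_sub (i : Fin n) (u : S i) (φ : S i → ℝ) :
    ∑ v, I.prob i u v * (φ v - φ u) = ∑ v, I.prob i u v * φ v - φ u := by
  simp only [mul_sub, sum_sub_distrib, ← sum_mul, sum_prob, one_mul]

section Primal

variable [∀ i, DecidableEq (S i)]

/-- Adding the self-loop term to both sides turns the total outflow into `P.x i u`, as each row of
probabilities sums to one. -/
theorem flow_iff (P : PrimalVars S) (i : Fin n) (u : S i) :
    ((if u = I.ρ i then I.s i * P.xκ i else 0) + ∑ v ∈ univ.erase u, P.x i v * I.prob i v u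
      = P.z i u + ∑ v ∈ univ.erase u, P.x i u * I.prob i u v) ↔
    (if u = I.ρ i then I.s i * P.xκ i else 0) + ∑ v, P.x i v * I.prob i v u
      = P.z i u + P.x i u := by
  have h1 := add_sum_erase univ (fun v => P.x i v * I.prob i v u) (mem_univ u)
  have h2 := add_sum_erase univ (fun v => P.x i u * I.prob i u v) (mem_univ u)
  rw [← mul_sum univ, sum_prob, mul_one] at h2
  constructor <;> intro h <;> linarith

theorem PrimalFeasible.flow' {I : Model n S} {P : PrimalVars S} (hP : I.PrimalFeasible P)
    (i : Fin n) (u : S i) :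
    (if u = I.ρ i then I.s i * P.xκ i else 0) + ∑ v, P.x i v * I.prob i v u
      = P.z i u + P.x i u :=
  (I.flow_iff P i u).1 (hP.flow i u)

/-- The flow equations of machine `i`, paired with a function on its states. -/
theorem PrimalFeasible.flow_pairing {I : Model n S} {P : PrimalVars S} (hP : I.PrimalFeasible P)
    (i : Fin n) (f : S i → ℝ) :
    P.xκ i * (I.s i * f (I.ρ i)) + ∑ u, P.x i u * ∑ v, I.prob i u v * f v
      = ∑ u, P.z i u * f u + ∑ u, P.x i u * f u := by
  have h : ∑ u, ((if u = I.ρ i then I.s i * P.xκ i else 0) + ∑ v, P.x i v * I.prob i v u) * f u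
      = ∑ u, (P.z i u + P.x i u) * f u :=
    sum_congr rfl fun u _ => by rw [hP.flow' i u]
  simp only [add_mul, sum_add_distrib, ite_mul, zero_mul, sum_ite_eq', mem_univ, if_true,
    sum_mul] at h
  rw [sum_comm] at h
  simp only [mul_sum]
  rw [← h]
  congr 1
  · ring
  · exact sum_congr rfl fun u _ => sum_congr rfl fun v _ => by ring

/-- The duality gap as a sum of products of complementary variables and slacks. -/
theorem dualObjective_sub_primalObjective {D : DualVars S} {P : PrimalVars S}
    (hD : I.DualFeasible D) (hP : I.PrimalFeasible P) :
    I.dualObjective D - I.primalObjective P =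
      D.lam * (I.M * (1 + P.ω) - ∑ i, P.xκ i) +
      ∑ i, (D.h i * (1 - P.ω - (P.xκ i + ∑ u, P.x i u)) +
        P.xκ i * (D.lam + D.h i - I.s i * D.phi i (I.ρ i)) +
        ∑ u, P.x i u * (D.h i - (I.r i u + ∑ v, I.prob i u v * (D.phi i v - D.phi i u))) +
        ∑ u, P.z i u * (D.phi i u + I.c i u)) := by
  have hi : ∀ i, (D.h i * (1 - P.ω - (P.xκ i + ∑ u, P.x i u)) +
        P.xκ i * (D.lam + D.h i - I.s i * D.phi i (I.ρ i)) +
        ∑ u, P.x i u * (D.h i - (I.r i u + ∑ v, I.prob i u v * (D.phi i v - D.phi i u))) +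
        ∑ u, P.z i u * (D.phi i u + I.c i u))
      = D.h i - P.ω * D.h i + D.lam * P.xκ i
        - ∑ u, (I.r i u * P.x i u - I.c i u * P.z i u) := by
    intro i
    -- Pairing the flow equations with `D.phi i` cancels every term containing the potential.
    have hf := hP.flow_pairing i (D.phi i)
    simp only [sum_prob_mul_sub]
    simp only [mul_sub, mul_add, sum_sub_distrib, sum_add_distrib]
    have e1 : ∑ u, P.x i u * D.h i = D.h i * ∑ u, P.x i u := by
      rw [mul_sum]; exact sum_congr rfl fun u _ => mul_comm _ _
    have e2 : ∑ u, P.x i u * I.r i u = ∑ u, I.r i u * P.x i u :=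
      sum_congr rfl fun u _ => mul_comm _ _
    have e3 : ∑ u, P.z i u * I.c i u = ∑ u, I.c i u * P.z i u :=
      sum_congr rfl fun u _ => mul_comm _ _
    rw [e1, e2, e3]
    linarith
  simp only [hi, sum_add_distrib, sum_sub_distrib, ← mul_sum]
  rw [dualObjective, primalObjective]
  simp only [sum_sub_distrib]
  linear_combination (-P.ω) * hD.balance

/-- Both balanced programs have feasible solutions with the same value. -/
theorem exists_feasible_pair : ∃ (D : DualVars S) (P : PrimalVars S),
    I.DualFeasible D ∧ I.PrimalFeasible P ∧ I.dualObjective D ≤ I.primalObjective P := by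
  let Q (a b : Σ i, S i) : ℝ := if h : a.1 = b.1 then I.prob b.1 (h ▸ a.2) b.2 else 0
  -- Standard form of the primal. The variables `z` are eliminated as slacks of the flow rows, and
  -- the free `ω` is a difference of two nonnegative variables, whose columns give the two halves of
  -- the balance equation. The dual variable of a flow row is `phi + c`, which is nonnegative.
  let A : Unit ⊕ Fin n ⊕ (Σ i, S i) → Fin n ⊕ (Σ i, S i) ⊕ Unit ⊕ Unit → ℝ
    | .inl _, .inl _ => 1
    | .inl _, .inr (.inl _) => 0
    | .inl _, .inr (.inr (.inl _)) => -I.M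
    | .inl _, .inr (.inr (.inr _)) => I.M
    | .inr (.inl i), .inl j => if i = j then 1 else 0
    | .inr (.inl i), .inr (.inl a) => if i = a.1 then 1 else 0
    | .inr (.inl _), .inr (.inr (.inl _)) => 1
    | .inr (.inl _), .inr (.inr (.inr _)) => -1
    | .inr (.inr b), .inl j => if b = ⟨j, I.ρ j⟩ then -I.s j else 0
    | .inr (.inr b), .inr (.inl a) => (if b = a then 1 else 0) - Q a b
    | .inr (.inr _), .inr (.inr (.inl _)) => 0
    | .inr (.inr _), .inr (.inr (.inr _)) => 0
  let b : Unit ⊕ Fin n ⊕ (Σ i, S i) → ℝ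
    | .inl _ => I.M
    | .inr (.inl _) => 1
    | .inr (.inr _) => 0
  let c : Fin n ⊕ (Σ i, S i) ⊕ Unit ⊕ Unit → ℝ
    | .inl i => -(I.s i * I.c i (I.ρ i))
    | .inr (.inl a) => I.r a.1 a.2 + I.c a.1 a.2 - ∑ v, I.prob a.1 a.2 v * I.c a.1 v
    | .inr (.inr _) => 0
  have row_lam (x : Fin n ⊕ (Σ i, S i) ⊕ Unit ⊕ Unit → ℝ) : ∑ k, A (.inl ()) k * x k
      = ∑ i, x (.inl i) - I.M * x (.inr (.inr (.inl ()))) + I.M * x (.inr (.inr (.inr ()))) := by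
    simp [A, Fintype.sum_sum_type]
    ring
  have row_h (x : Fin n ⊕ (Σ i, S i) ⊕ Unit ⊕ Unit → ℝ) (i : Fin n) : ∑ k, A (.inr (.inl i)) k * x k
      = x (.inl i) + ∑ u, x (.inr (.inl ⟨i, u⟩)) + x (.inr (.inr (.inl ())))
        - x (.inr (.inr (.inr ()))) := by
    have h : ∑ a : Σ i, S i, (if i = a.1 then (1 : ℝ) else 0) * x (.inr (.inl a))
        = ∑ u, x (.inr (.inl ⟨i, u⟩)) := by
      rw [Fintype.sum_sigma, Fintype.sum_eq_single i]
      · simp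
      · intro j hj; simp [hj.symm]
    simp only [A, Fintype.sum_sum_type, h]
    simp
    ring
  have row_phi (x : Fin n ⊕ (Σ i, S i) ⊕ Unit ⊕ Unit → ℝ) (i : Fin n) (u : S i) :
      ∑ k, A (.inr (.inr ⟨i, u⟩)) k * x k
      = x (.inr (.inl ⟨i, u⟩)) - ∑ v, x (.inr (.inl ⟨i, v⟩)) * I.prob i v u
        - (if u = I.ρ i then I.s i * x (.inl i) else 0) := by
    have h1 : ∑ a : Σ i, S i, Q a ⟨i, u⟩ * x (.inr (.inl a))
        = ∑ v, x (.inr (.inl ⟨i, v⟩)) * I.prob i v u := by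
      rw [Fintype.sum_sigma, Fintype.sum_eq_single i]
      · exact sum_congr rfl fun v _ => by simp [Q, mul_comm]
      · intro j hj; simp [Q, hj]
    have h2 : ∑ j, (if (⟨i, u⟩ : Σ i, S i) = ⟨j, I.ρ j⟩ then -(I.s j : ℝ) else 0) * x (.inl j)
        = -(if u = I.ρ i then I.s i * x (.inl i) else 0) := by
      rw [Fintype.sum_eq_single i]
      · simp; split_ifs <;> simp
      · intro j hj
        rw [if_neg, zero_mul]
        intro h
        exact hj (congrArg Sigma.fst h).symm
    simp only [A, Fintype.sum_sum_type, h2, sub_mul, sum_sub_distrib, h1]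
    simp
    ring
  have col_κ (y : Unit ⊕ Fin n ⊕ (Σ i, S i) → ℝ) (i : Fin n) : ∑ j, A j (.inl i) * y j
      = y (.inl ()) + y (.inr (.inl i)) - I.s i * y (.inr (.inr ⟨i, I.ρ i⟩)) := by
    simp [A, Fintype.sum_sum_type]
    ring
  have col_x (y : Unit ⊕ Fin n ⊕ (Σ i, S i) → ℝ) (i : Fin n) (u : S i) :
      ∑ j, A j (.inr (.inl ⟨i, u⟩)) * y j
      = y (.inr (.inl i)) + y (.inr (.inr ⟨i, u⟩))
        - ∑ v, I.prob i u v * y (.inr (.inr ⟨i, v⟩)) := by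
    have h1 : ∑ a : Σ i, S i, Q ⟨i, u⟩ a * y (.inr (.inr a))
        = ∑ v, I.prob i u v * y (.inr (.inr ⟨i, v⟩)) := by
      rw [Fintype.sum_sigma, Fintype.sum_eq_single i]
      · exact sum_congr rfl fun v _ => by simp [Q]
      · intro j hj; simp [Q, hj.symm]
    simp only [A, Fintype.sum_sum_type, sub_mul, sum_sub_distrib, h1]
    simp
    ring
  have col_neg (y : Unit ⊕ Fin n ⊕ (Σ i, S i) → ℝ) : ∑ j, A j (.inr (.inr (.inl ()))) * y j
      = -(I.M * y (.inl ())) + ∑ i, y (.inr (.inl i)) := by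
    simp [A, Fintype.sum_sum_type]
  have col_pos (y : Unit ⊕ Fin n ⊕ (Σ i, S i) → ℝ) : ∑ j, A j (.inr (.inr (.inr ()))) * y j
      = I.M * y (.inl ()) - ∑ i, y (.inr (.inl i)) := by
    simp [A, Fintype.sum_sum_type]
    ring
  have hM : (0 : ℝ) < I.M := by exact_mod_cast I.M_pos
  have hr (i) : 0 ≤ ∑ u, I.r i u := sum_nonneg fun u _ => I.r_nonneg i u
  obtain ⟨x, y, hx, hA, hy, hB, hle⟩ := exists_primal_dual_of_feasible A b c
    ⟨0, fun _ => le_rfl, by rintro (_ | _ | _) <;> simp [b]⟩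
    -- The dual point with `phi = 0`, `h i` the sum of the rewards of machine `i`, and `lam` chosen
    -- for balance.
    ⟨Sum.elim (fun _ => (∑ i, ∑ u, I.r i u) / I.M)
        (Sum.elim (fun i => ∑ u, I.r i u) fun a => I.c a.1 a.2), by
      rintro (_ | i | a)
      · exact div_nonneg (sum_nonneg fun i _ => hr i) hM.le
      · exact hr i
      · exact I.c_nonneg _ _, by
      rintro (i | ⟨i, u⟩ | _ | _)
      · rw [col_κ]
        have := div_nonneg (sum_nonneg fun i (_ : i ∈ univ) => hr i) hM.le
        simp only [Sum.elim_inl, Sum.elim_inr, c]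
        linarith [hr i]
      · rw [col_x]
        have := single_le_sum (fun v _ => I.r_nonneg i v) (mem_univ u)
        simp only [Sum.elim_inl, Sum.elim_inr, c]
        linarith
      · rw [col_neg]
        simp [c, mul_div_cancel₀ _ hM.ne']
      · rw [col_pos]
        simp [c, mul_div_cancel₀ _ hM.ne']⟩
  have h1 := hA (.inl ())
  have h2 := fun i => hA (.inr (.inl i))
  have h3 := fun i u => hA (.inr (.inr ⟨i, u⟩))
  have h4 := fun i => hB (.inl i)
  have h5 := fun i u => hB (.inr (.inl ⟨i, u⟩))
  have h6 := hB (.inr (.inr (.inl ())))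
  have h7 := hB (.inr (.inr (.inr ())))
  simp only [row_lam, row_h, row_phi, col_κ, col_x, col_neg, col_pos, b, c] at h1 h2 h3 h4 h5 h6 h7
  let D : DualVars S := ⟨y (.inl ()), fun i => y (.inr (.inl i)),
    fun i u => y (.inr (.inr ⟨i, u⟩)) - I.c i u⟩
  let P : PrimalVars S := ⟨fun i u => x (.inr (.inl ⟨i, u⟩)), fun i => x (.inl i),
    fun i u => (if u = I.ρ i then I.s i * x (.inl i) else 0)
      + ∑ v, x (.inr (.inl ⟨i, v⟩)) * I.prob i v u - x (.inr (.inl ⟨i, u⟩)),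
    x (.inr (.inr (.inl ()))) - x (.inr (.inr (.inr ())))⟩
  have hP : I.PrimalFeasible P :=
    { capacity := by simp only [P]; linarith
      mass := fun i => by simp only [P]; linarith [h2 i]
      flow := fun i u => by rw [flow_iff]; simp only [P]; ring
      x_nonneg := fun i u => hx _
      xκ_nonneg := fun i => hx _
      z_nonneg := fun i u => by simp only [P]; linarith [h3 i u] }
  refine ⟨D, P, ?_, hP, ?_⟩
  · exact
    { repair := fun i => by
        have := h4 i
        simp only [D, mul_sub]
        linarith
      active := fun i u => by
        have := h5 i u
        rw [sum_prob_mul_sub]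
        simp only [D, mul_sub, sum_sub_distrib]
        linarith
      move := fun i u => by
        simp only [D, sub_add_cancel]
        exact hy _
      balance := by simp only [D]; linarith
      lam_nonneg := hy _
      h_nonneg := fun i => hy _ }
  · have e1 : ∑ j, b j * y j = I.dualObjective D := by
      simp [b, D, dualObjective, Fintype.sum_sum_type]
    have e2 : ∑ k, c k * x k = I.primalObjective P := by
      rw [primalObjective]
      simp only [c, Fintype.sum_sum_type, Fintype.sum_sigma, zero_mul, sum_const_zero, add_zero]
      rw [← sum_add_distrib]
      refine sum_congr rfl fun i _ => ?_
      -- This expresses the repair costs through `x` and `xκ`, which matches the objective after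
      -- elimination of `z`.
      have hf := hP.flow_pairing i (I.c i)
      simp only [P] at hf ⊢
      simp only [sum_sub_distrib, sub_mul, add_mul]
      simp only [mul_comm (I.c i _), mul_comm (I.r i _), sum_add_distrib]
      have e3 : ∑ u, (∑ v, I.prob i u v * I.c i v) * x (.inr (.inl ⟨i, u⟩))
        = ∑ u, x (.inr (.inl ⟨i, u⟩)) * ∑ v, I.prob i u v * I.c i v :=
        sum_congr rfl fun u _ => mul_comm _ _
      rw [e3]
      linarith
    linarith


end Primal

end Model

/-! ### Drift functions of finite Markov chains -/

/-- If a closed set `A` of a finite Markov chain is reachable from every state, some function is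
harmonic on `A` and strictly increases in expectation outside of `A`. -/
theorem exists_drift_of_reachable {S : Type*} [Fintype S] (p : S → S → ℝ)
    (hp : ∀ u v, 0 ≤ p u v) (hsum : ∀ u, ∑ v, p u v = 1) (A : Set S)
    (hA : ∀ u ∈ A, ∀ v, 0 < p u v → v ∈ A)
    (hreach : ∀ u, ∃ w ∈ A, Relation.ReflTransGen (fun a b => 0 < p a b) u w) :
    ∃ g : S → ℝ, (∀ u ∈ A, ∑ v, p u v * (g v - g u) = 0) ∧
      ∀ u ∉ A, 0 < ∑ v, p u v * (g v - g u) := by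
  classical
  -- The states with a path of exactly `m` steps into `A`; `d` below is the distance to `A`.
  let R (m : ℕ) : Set S :=
    Nat.rec (motive := fun _ => Set S) A (fun _ X => {u | ∃ v ∈ X, 0 < p u v}) m
  have hR : ∀ u, ∃ m, u ∈ R m := fun u => by
    obtain ⟨w, hw, h⟩ := hreach u
    induction h using Relation.ReflTransGen.head_induction_on with
    | refl => exact ⟨0, hw⟩
    | head h1 _ ih =>
      obtain ⟨m, hm⟩ := ih
      exact ⟨m + 1, _, hm, h1⟩
  let d (u : S) : ℕ := Nat.find (hR u)
  have hd0 : ∀ u ∈ A, d u = 0 := fun u hu => (Nat.find_eq_zero (hR u)).2 hu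
  have hd : ∀ u ∉ A, ∃ v, 0 < p u v ∧ d v + 1 ≤ d u := fun u hu => by
    have hne : d u ≠ 0 := fun h => hu ((Nat.find_eq_zero (hR u)).1 h)
    obtain ⟨m, hm⟩ := Nat.exists_eq_succ_of_ne_zero hne
    have h : u ∈ R (d u) := Nat.find_spec (hR u)
    rw [hm] at h
    obtain ⟨v, hv, hpv⟩ := h
    refine ⟨v, hpv, ?_⟩
    rw [hm]
    exact Nat.succ_le_succ (Nat.find_min' (hR v) hv)
  -- With `ε` below all positive transition probabilities, a single successor one step closer to `A`
  -- already makes the mean of `ε ^ d` exceed its present value.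
  obtain ⟨ε, ⟨hε0, hε1⟩, hε⟩ : ∃ ε : ℝ, (0 < ε ∧ ε < 1) ∧ ∀ u v, 0 < p u v → ε < p u v := by
    have h1 : ∀ᶠ ε : ℝ in nhdsWithin 0 (Set.Ioi 0), 0 < ε ∧ ε < 1 :=
      Ioo_mem_nhdsGT one_pos
    have h2 : ∀ᶠ ε : ℝ in nhdsWithin 0 (Set.Ioi 0), ∀ u v, 0 < p u v → ε < p u v := by
      refine eventually_all.2 fun u => eventually_all.2 fun v => ?_
      by_cases h : 0 < p u v
      · filter_upwards [Ioo_mem_nhdsGT h] with ε hε _ using hε.2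
      · exact Eventually.of_forall fun ε h' => absurd h' h
    exact (h1.and h2).exists
  refine ⟨fun u => ε ^ d u, fun u hu => sum_eq_zero fun v _ => ?_, fun u hu => ?_⟩
  · rcases (hp u v).eq_or_lt with h | h
    · rw [← h, zero_mul]
    · simp [hd0 u hu, hd0 v (hA u hu v h)]
  · simp only [mul_sub, sum_sub_distrib, ← sum_mul, hsum, one_mul, sub_pos]
    obtain ⟨v, hv, hdv⟩ := hd u hu
    calc ε ^ d u ≤ ε ^ (d v + 1) := pow_le_pow_of_le_one hε0.le hε1.le hdv
      _ = ε * ε ^ d v := pow_succ' _ _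
      _ < p u v * ε ^ d v := mul_lt_mul_of_pos_right (hε u v hv) (pow_pos hε0 _)
      _ ≤ ∑ v, p u v * ε ^ d v :=
        single_le_sum (f := fun v => p u v * ε ^ d v)
          (fun v _ => mul_nonneg (hp u v) (pow_nonneg hε0.le _)) (mem_univ v)

/-! ### Complementary slackness, charged states and certificates -/

namespace Model

variable {n : ℕ} {S : Fin n → Type u} [∀ i, Fintype (S i)] [∀ i, DecidableEq (S i)]
  {I : Model n S} {D : DualVars S} {P : PrimalVars S}

-- Weak duality is read off the gap formula, all of whose products are nonnegative; a feasible pair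
-- without gap is then optimal on both sides.
variable (I) in
theorem exists_optimal_pair : ∃ (D : DualVars S) (P : PrimalVars S),
    I.DualOptimal D ∧ I.PrimalOptimal P ∧ I.dualObjective D = I.primalObjective P := by
  have weak : ∀ (D : DualVars S) (P : PrimalVars S), I.DualFeasible D → I.PrimalFeasible P →
      I.primalObjective P ≤ I.dualObjective D := by
    intro D P hD hP
    rw [← sub_nonneg, I.dualObjective_sub_primalObjective hD hP]
    refine add_nonneg (mul_nonneg hD.lam_nonneg (sub_nonneg.2 hP.capacity))
      (sum_nonneg fun i _ => add_nonneg (add_nonneg (add_nonneg ?_ ?_) ?_) ?_)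
    · exact mul_nonneg (hD.h_nonneg i) (sub_nonneg.2 (hP.mass i))
    · exact mul_nonneg (hP.xκ_nonneg i) (sub_nonneg.2 (hD.repair i))
    · exact sum_nonneg fun u _ => mul_nonneg (hP.x_nonneg i u) (sub_nonneg.2 (hD.active i u))
    · exact sum_nonneg fun u _ => mul_nonneg (hP.z_nonneg i u) (hD.move i u)
  obtain ⟨D, P, hD, hP, hle⟩ := I.exists_feasible_pair
  exact ⟨D, P, ⟨hD, fun D' hD' => hle.trans (weak D' P hD' hP)⟩,
    ⟨hP, fun P' hP' => (weak D P' hD hP').trans hle⟩, hle.antisymm (weak D P hD hP)⟩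

theorem dualObjective_eq_primalObjective (hD : I.DualOptimal D) (hP : I.PrimalOptimal P) :
    I.dualObjective D = I.primalObjective P := by
  obtain ⟨D', P', hD', hP', h⟩ := I.exists_optimal_pair
  rw [(hD.2 D' hD'.1).antisymm (hD'.2 D hD.1), h]
  exact (hP.2 P' hP'.1).antisymm (hP'.2 P hP.1)

/-- The complementary slackness conditions. -/
structure ComplementarySlack (I : Model n S) (D : DualVars S) (P : PrimalVars S) : Prop where
  mass : ∀ i, 0 < D.h i → P.xκ i + ∑ u, P.x i u = 1 - P.ω
  repair : ∀ i, 0 < P.xκ i → D.lam + D.h i = I.s i * D.phi i (I.ρ i)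
  active : ∀ i u, 0 < P.x i u →
    D.h i = I.r i u + ∑ v, I.prob i u v * (D.phi i v - D.phi i u)
  move : ∀ i u, 0 < P.z i u → D.phi i u + I.c i u = 0

/-- The gap vanishes and is a sum of nonnegative products, so each product vanishes. -/
theorem complementarySlack (hD : I.DualOptimal D) (hP : I.PrimalOptimal P) :
    I.ComplementarySlack D P := by
  have hgap := I.dualObjective_sub_primalObjective hD.1 hP.1
  rw [dualObjective_eq_primalObjective hD hP, sub_self] at hgap
  have n0 := mul_nonneg hD.1.lam_nonneg (sub_nonneg.2 hP.1.capacity)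
  have n1 i := mul_nonneg (hD.1.h_nonneg i) (sub_nonneg.2 (hP.1.mass i))
  have n2 i := mul_nonneg (hP.1.xκ_nonneg i) (sub_nonneg.2 (hD.1.repair i))
  have n3 i u := mul_nonneg (hP.1.x_nonneg i u) (sub_nonneg.2 (hD.1.active i u))
  have n4 i u := mul_nonneg (hP.1.z_nonneg i u) (hD.1.move i u)
  have n3' i := sum_nonneg fun u (_ : u ∈ univ) => n3 i u
  have n4' i := sum_nonneg fun u (_ : u ∈ univ) => n4 i u
  have n5 i := add_nonneg (add_nonneg (add_nonneg (n1 i) (n2 i)) (n3' i)) (n4' i)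
  have hz := (sum_eq_zero_iff_of_nonneg fun i (_ : i ∈ univ) => n5 i).1
    (by linarith [sum_nonneg fun i (_ : i ∈ univ) => n5 i])
  have z i := hz i (mem_univ i)
  refine ⟨fun i hi => ?_, fun i hi => ?_, fun i u hu => ?_, fun i u hu => ?_⟩
  · have h : D.h i * (1 - P.ω - (P.xκ i + ∑ u, P.x i u)) = 0 := by
      linarith [z i, n1 i, n2 i, n3' i, n4' i]
    linarith [(mul_eq_zero.1 h).resolve_left hi.ne']
  · have h : P.xκ i * (D.lam + D.h i - I.s i * D.phi i (I.ρ i)) = 0 := by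
      linarith [z i, n1 i, n2 i, n3' i, n4' i]
    linarith [(mul_eq_zero.1 h).resolve_left hi.ne']
  · have h := (sum_eq_zero_iff_of_nonneg fun u (_ : u ∈ univ) => n3 i u).1
      (by linarith [z i, n1 i, n2 i, n3' i, n4' i]) u (mem_univ u)
    linarith [(mul_eq_zero.1 h).resolve_left hu.ne']
  · have h := (sum_eq_zero_iff_of_nonneg fun u (_ : u ∈ univ) => n4 i u).1
      (by linarith [z i, n1 i, n2 i, n3' i, n4' i]) u (mem_univ u)
    exact (mul_eq_zero.1 h).resolve_left hu.ne'

/-- Transitions between active states conserve mass, so the flow into repair equals the flow out of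
it: pair the flow equations with the constant one. -/
theorem PrimalFeasible.sum_z (hP : I.PrimalFeasible P) (i : Fin n) :
    ∑ u, P.z i u = I.s i * P.xκ i := by
  have h := hP.flow_pairing i 1
  simp only [Pi.one_apply, mul_one, sum_prob] at h
  linarith

theorem PrimalFeasible.xκ_pos_of_z_pos (hP : I.PrimalFeasible P) {i : Fin n} {u : S i}
    (hu : 0 < P.z i u) : 0 < P.xκ i := by
  have h : 0 < ∑ u, P.z i u := sum_pos' (fun v _ => hP.z_nonneg i v) ⟨u, mem_univ u, hu⟩
  rw [hP.sum_z] at h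
  exact pos_of_mul_pos_right h (I.s i).2

theorem PrimalFeasible.charged_of_xκ_pos (hP : I.PrimalFeasible P) {i : Fin n}
    (hi : 0 < P.xκ i) : 0 < P.x i (I.ρ i) + P.z i (I.ρ i) := by
  have h := hP.flow' i (I.ρ i)
  have h1 : 0 ≤ ∑ v, P.x i v * I.prob i v (I.ρ i) :=
    sum_nonneg fun v _ => mul_nonneg (hP.x_nonneg i v) (I.prob_nonneg i v _)
  have h2 : (0 : ℝ) < I.s i * P.xκ i := mul_pos (by exact_mod_cast I.s_pos i) hi
  rw [if_pos rfl] at h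
  linarith

/-- Positive inflow forces positive `x + z`; this is why a machine started in a charged state stays
among charged states. -/
theorem PrimalFeasible.charged_of_prob_pos (hP : I.PrimalFeasible P) {i : Fin n} {u v : S i}
    (hu : 0 < P.x i u) (huv : 0 < I.prob i u v) : 0 < P.x i v + P.z i v := by
  have h := hP.flow' i v
  have h1 : 0 < ∑ w, P.x i w * I.prob i w v :=
    sum_pos' (fun w _ => mul_nonneg (hP.x_nonneg i w) (I.prob_nonneg i w _))
      ⟨u, mem_univ u, mul_pos hu huv⟩
  have h2 : (0 : ℝ) ≤ if v = I.ρ i then I.s i * P.xκ i else 0 := by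
    split_ifs
    exacts [mul_nonneg (I.s i).2 (hP.xκ_nonneg i), le_rfl]
  linarith

/-- An uncharged machine with `h i > 0` would force `ω = 1` by its tight mass constraint. Then no
machine has any mass and the optimal value is zero, whereas the dual objective is at least `2 * h
i`. -/
theorem exists_charged (hD : I.DualOptimal D) (hP : I.PrimalOptimal P) {i : Fin n}
    (hi : 0 < D.h i) : ∃ u, 0 < P.x i u + P.z i u := by
  by_contra! hcon
  have hx : ∀ u, P.x i u = 0 := fun u => by
    linarith [hcon u, hP.1.x_nonneg i u, hP.1.z_nonneg i u]
  have hz : ∀ u, P.z i u = 0 := fun u => by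
    linarith [hcon u, hP.1.x_nonneg i u, hP.1.z_nonneg i u]
  have hs : ∀ i, (I.s i : ℝ) ≠ 0 := fun i => by exact_mod_cast (I.s_pos i).ne'
  have hκ : P.xκ i = 0 := by
    have h := hP.1.sum_z i
    simp only [hz, sum_const_zero] at h
    exact (mul_eq_zero.1 h.symm).resolve_left (hs i)
  have hω := (complementarySlack hD hP).mass i hi
  simp only [hx, hκ, sum_const_zero] at hω
  have hobj : I.primalObjective P = 0 := by
    refine sum_eq_zero fun j _ => ?_
    have hm := hP.1.mass j
    have hxj := sum_nonneg fun u (_ : u ∈ univ) => hP.1.x_nonneg j u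
    have hκj := hP.1.xκ_nonneg j
    have h1 : P.xκ j = 0 := by linarith
    have h2 := (sum_eq_zero_iff_of_nonneg fun u (_ : u ∈ univ) => hP.1.x_nonneg j u).1
      (by linarith)
    have h3 := (sum_eq_zero_iff_of_nonneg fun u (_ : u ∈ univ) => hP.1.z_nonneg j u).1
      (by rw [hP.1.sum_z, h1, mul_zero])
    exact sum_eq_zero fun u hu => by rw [h2 u hu, h3 u hu, mul_zero, mul_zero, sub_zero]
  rw [← dualObjective_eq_primalObjective hD hP, dualObjective, hD.1.balance] at hobj
  have := single_le_sum (fun j _ => hD.1.h_nonneg j) (mem_univ i)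
  linarith

theorem exists_goodStart (hD : I.DualOptimal D) (hP : I.PrimalOptimal P) :
    ∃ σ₀ : ∀ i, S i, I.GoodStart D P σ₀ := by
  have h : ∀ i, ∃ u, 0 < D.h i → 0 < P.x i u + P.z i u := fun i => by
    by_cases hi : 0 < D.h i
    · exact (exists_charged hD hP hi).imp fun u hu _ => hu
    · exact ⟨I.ρ i, fun h => absurd h hi⟩
  choose σ₀ hσ₀ using h
  exact ⟨σ₀, fun i hi => Or.inl (hσ₀ i hi)⟩

/-- A potential on the active states of machine `i` that certifies the rewards of a balanced
policy, on a set `G` of states that such a policy does not leave. -/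
structure Certificate (I : Model n S) (D : DualVars S) (P : PrimalVars S) (i : Fin n)
    (ψ : S i → ℝ) (G : Set (S i)) : Prop where
  stay : ∀ u ∈ G, ¬ (0 < D.h i ∧ 0 < P.z i u) →
    D.h i ≤ I.r i u + ∑ v, I.prob i u v * (ψ v - ψ u)
  closed : ∀ u ∈ G, ¬ (0 < D.h i ∧ 0 < P.z i u) → ∀ v, 0 < I.prob i u v → v ∈ G
  move : ∀ u ∈ G, 0 < D.h i → 0 < P.z i u → ψ u ≤ -I.c i u
  repair : ∀ u ∈ G, 0 < D.h i → 0 < P.z i u → D.lam + D.h i ≤ I.s i * ψ (I.ρ i)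
  restart : ∀ u ∈ G, 0 < D.h i → 0 < P.z i u → I.ρ i ∈ G

theorem exists_certificate (hD : I.DualOptimal D) (hP : I.PrimalOptimal P) {σ₀ : ∀ i, S i}
    (hσ₀ : I.GoodStart D P σ₀) (i : Fin n) :
    ∃ (ψ : S i → ℝ) (G : Set (S i)), I.Certificate D P i ψ G ∧ σ₀ i ∈ G := by
  have cs := complementarySlack hD hP
  by_cases hi : 0 < D.h i
  swap
  -- Such a machine is never moved, and nonnegative rewards suffice.
  · have hi0 : D.h i = 0 := le_antisymm (not_lt.1 hi) (hD.1.h_nonneg i)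
    exact ⟨0, Set.univ, ⟨fun u _ _ => by simpa [hi0] using I.r_nonneg i u,
      fun _ _ _ _ _ => trivial, fun _ _ h => absurd h hi, fun _ _ h => absurd h hi,
      fun _ _ _ _ => trivial⟩, trivial⟩
  have x_pos : ∀ u, 0 < P.x i u + P.z i u → ¬ 0 < P.z i u → 0 < P.x i u := fun u h1 h2 => by
    linarith
  by_cases hstart : 0 < P.x i (σ₀ i) + P.z i (σ₀ i)
  · refine ⟨D.phi i, {u | 0 < P.x i u + P.z i u}, ⟨fun u hu hz => ?_, fun u hu hz v huv => ?_,
      fun u _ _ hz => ?_, fun u _ _ hz => ?_, fun u _ _ hz => ?_⟩, hstart⟩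
    · exact (cs.active i u (x_pos u hu fun h => hz ⟨hi, h⟩)).le
    · exact hP.1.charged_of_prob_pos (x_pos u hu fun h => hz ⟨hi, h⟩) huv
    · linarith [cs.move i u hz]
    · exact (cs.repair i (hP.1.xκ_pos_of_z_pos hz)).le
    · exact hP.1.charged_of_xκ_pos (hP.1.xκ_pos_of_z_pos hz)
  obtain ⟨hρ, w, hw⟩ := (hσ₀ i hi).resolve_left hstart
  -- An uncharged `ρ i` means `xκ i = 0`, hence no `z`: the machine is never repaired.
  rw [hρ] at hstart
  have hz : ∀ u, ¬ 0 < P.z i u := fun u h =>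
    hstart (hP.1.charged_of_xκ_pos (hP.1.xκ_pos_of_z_pos h))
  have hclosed : ∀ u, 0 < P.x i u → ∀ v, 0 < I.prob i u v → 0 < P.x i v := fun u hu v huv =>
    x_pos v (hP.1.charged_of_prob_pos hu huv) (hz v)
  obtain ⟨u₀, hu₀⟩ := exists_charged hD hP hi
  have hsupp : ∀ w, Relation.ReflTransGen (fun a b => 0 < I.prob i a b) u₀ w →
      0 < P.x i w := fun w h => by
    induction h with
    | refl => exact x_pos u₀ hu₀ (hz u₀)
    | tail _ h2 ih => exact hclosed _ ih _ h2
  obtain ⟨g, hg0, hg⟩ := exists_drift_of_reachable (I.prob i) (I.prob_nonneg i) (I.sum_prob i)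
    {u | 0 < P.x i u} hclosed fun u => ⟨w, hsupp w (hw u₀), hw u⟩
  let need (u : S i) : ℝ := D.h i - (I.r i u + ∑ v, I.prob i u v * (D.phi i v - D.phi i u))
  let drift (u : S i) : ℝ := ∑ v, I.prob i u v * (g v - g u)
  -- `K` makes the added drift cover the deficit of `D.phi` outside the support of `x`; on the
  -- support the drift is zero and the constraint is tight.
  obtain ⟨K, hK⟩ := Finite.bddAbove_range fun u => need u / drift u
  refine ⟨fun u => D.phi i u + K * g u, Set.univ, ⟨fun u _ _ => ?_, fun _ _ _ _ _ => trivial,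
    fun u _ _ h => absurd h (hz u), fun u _ _ h => absurd h (hz u), fun _ _ _ _ => trivial⟩,
    trivial⟩
  have hsplit : ∑ v, I.prob i u v * (D.phi i v + K * g v - (D.phi i u + K * g u))
      = ∑ v, I.prob i u v * (D.phi i v - D.phi i u) + K * drift u := by
    simp only [drift, mul_sum, ← sum_add_distrib]
    exact sum_congr rfl fun v _ => by ring
  rw [hsplit]
  by_cases hu : 0 < P.x i u
  · have h1 : drift u = 0 := hg0 u hu
    rw [h1, mul_zero, add_zero]
    exact (cs.active i u hu).le
  · have h1 : need u ≤ K * drift u := (div_le_iff₀ (hg u hu)).1 (hK ⟨u, rfl⟩)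
    simp only [need] at h1
    linarith

end Model

/-! ### Expectations over finite types -/

/-- The expectation of a function under a distribution on a finite type. -/
noncomputable def expect {α : Type*} [Fintype α] (μ : PMF α) (f : α → ℝ) : ℝ :=
  ∑ a, (μ a).toReal * f a

section Expect

variable {α β : Type*} [Fintype α] [Fintype β]

theorem sum_toReal (μ : PMF α) : ∑ a, (μ a).toReal = 1 := by
  have h := μ.tsum_coe
  rw [tsum_fintype] at h
  rw [← ENNReal.toReal_sum fun a _ => μ.apply_ne_top a, h, ENNReal.toReal_one]

theorem expect_pure (a : α) (f : α → ℝ) : expect (PMF.pure a) f = f a := by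
  classical
  rw [expect, Fintype.sum_eq_single a]
  · simp
  · intro b hb
    simp [PMF.pure_apply, hb]

theorem expect_bind (μ : PMF α) (κ : α → PMF β) (f : β → ℝ) :
    expect (μ.bind κ) f = expect μ fun a => expect (κ a) f := by
  have h : ∀ b, ((μ.bind κ) b).toReal = ∑ a, (μ a).toReal * (κ a b).toReal := fun b => by
    rw [PMF.bind_apply, tsum_fintype, ENNReal.toReal_sum fun a _ =>
      ENNReal.mul_ne_top (μ.apply_ne_top a) ((κ a).apply_ne_top b)]
    simp only [ENNReal.toReal_mul]
  simp only [expect, h, sum_mul, mul_sum]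
  rw [sum_comm]
  exact sum_congr rfl fun a _ => sum_congr rfl fun b _ => by ring

theorem expect_map (μ : PMF α) (g : α → β) (f : β → ℝ) :
    expect (μ.map g) f = expect μ fun a => f (g a) := by
  rw [← PMF.bind_pure_comp, expect_bind]
  exact sum_congr rfl fun a _ => by simp only [Function.comp_apply, expect_pure]

theorem expect_const (μ : PMF α) (r : ℝ) : expect μ (fun _ => r) = r := by
  rw [expect, ← sum_mul, sum_toReal, one_mul]

theorem expect_add (μ : PMF α) (f g : α → ℝ) :
    expect μ (fun a => f a + g a) = expect μ f + expect μ g := by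
  simp only [expect, mul_add, sum_add_distrib]

theorem expect_sum {ι : Type*} (s : Finset ι) (μ : PMF α) (f : ι → α → ℝ) :
    expect μ (fun a => ∑ i ∈ s, f i a) = ∑ i ∈ s, expect μ (f i) := by
  simp only [expect, mul_sum]
  exact sum_comm

theorem expect_mono (μ : PMF α) {f g : α → ℝ} (h : ∀ a ∈ μ.support, f a ≤ g a) :
    expect μ f ≤ expect μ g := by
  refine sum_le_sum fun a _ => ?_
  by_cases ha : a ∈ μ.support
  · exact mul_le_mul_of_nonneg_left (h a ha) ENNReal.toReal_nonneg
  · rw [PMF.apply_eq_zero_iff μ a |>.2 ha]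
    simp

theorem expect_coin (s : ℝ≥0) (hs : s ≤ 1) (f : Bool → ℝ) :
    expect (coin s hs) f = s * f true + (1 - s) * f false := by
  have h : (1 - (s : ℝ≥0∞)).toReal = 1 - (s : ℝ) := by
    rw [ENNReal.toReal_sub_of_le (by exact_mod_cast hs) ENNReal.one_ne_top]
    simp
  simp [expect, coin, PMF.ofFintype_apply, h]

end Expect

theorem mem_support_independent {n : ℕ} {A : Fin n → Type u} [∀ i, Fintype (A i)]
    (q : ∀ i, PMF (A i)) {a : ∀ i, A i} (ha : a ∈ (independent q).support) (i : Fin n) :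
    a i ∈ (q i).support := by
  rw [independent, PMF.mem_support_ofFintype_iff] at ha
  exact (prod_ne_zero_iff.1 ha) i (mem_univ i)

theorem expect_independent {n : ℕ} {A : Fin n → Type u} [∀ i, Fintype (A i)]
    (q : ∀ i, PMF (A i)) (i : Fin n) (f : A i → ℝ) :
    expect (independent q) (fun a => f (a i)) = expect (q i) f := by
  classical
  -- Placing `f` in the factor `i` only makes the expectation a product of sums, in which every
  -- other factor is one.
  let F (j : Fin n) (a : A j) : ℝ :=
    (q j a).toReal * if h : j = i then f (h ▸ a) else 1
  have h := Finset.prod_univ_sum (fun j => (Finset.univ : Finset (A j))) F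
  rw [Fintype.piFinset_univ] at h
  have h1 : ∀ a : ∀ j, A j, ∏ j, F j (a j) = (independent q a).toReal * f (a i) := fun a => by
    simp only [F, prod_mul_distrib]
    congr 1
    · rw [independent, PMF.ofFintype_apply, ENNReal.toReal_prod]
    · rw [Fintype.prod_eq_single i fun j hj => by simp [hj]]
      simp
  have h2 : ∏ j, ∑ a, F j a = expect (q i) f := by
    rw [Fintype.prod_eq_single i fun j hj => by simp [F, hj, sum_toReal]]
    simp [F, expect]
  rw [← h2, h]
  exact (sum_congr rfl fun a _ => h1 a).symm

namespace Model

theorem BalancedDecision.not_charged {n : ℕ} {S : Fin n → Type u} {I : Model n S}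
    {D : DualVars S} {P : PrimalVars S} {σ : Config S} {a : Decision n}
    (ha : I.BalancedDecision D P σ a) {i : Fin n} {u : S i}
    (hu : σ i = .active u) (hm : i ∉ a.move) :
    ¬ (0 < D.h i ∧ 0 < P.z i u) :=
  fun h => hm ((ha.move_iff i).2 ⟨h.1, u, hu, h.2⟩)

variable {n : ℕ} {S : Fin n → Type u} [∀ i, Fintype (S i)] (I : Model n S)

/-! ### Potentials -/

/-- The potential of a machine: given by a function on its active states and zero in repair. -/
def statusPotential {A : Type u} (ψ : A → ℝ) : Status A → ℝ
  | .active u => ψ u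
  | .queued => 0
  | .inRepair => 0

/-- The total potential of all machines. -/
noncomputable def potential (ψ : ∀ i, S i → ℝ) (σ : Config S) : ℝ :=
  ∑ i, statusPotential (ψ i) (σ i)

theorem expect_step_potential (ψ : ∀ i, S i → ℝ) (σ : Config S) (a : Decision n) :
    expect (I.step σ a) (potential ψ)
      = ∑ i, expect (I.machineStep a i (σ i)) (statusPotential (ψ i)) := by
  unfold potential
  rw [expect_sum]
  exact sum_congr rfl fun i _ => expect_independent _ i _

theorem expect_machineStep_serve (ψ : ∀ i, S i → ℝ) {a : Decision n} {i : Fin n}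
    (hi : i ∈ a.serve) (σ : Status (S i)) :
    expect (I.machineStep a i σ) (statusPotential (ψ i)) = I.s i * ψ i (I.ρ i) := by
  unfold machineStep
  rw [if_pos hi, expect_map, expect_coin]
  simp [statusPotential]

theorem expect_machineStep_active (ψ : ∀ i, S i → ℝ) {a : Decision n} {i : Fin n}
    (hi : i ∉ a.serve) (hm : i ∉ a.move) (u : S i) :
    expect (I.machineStep a i (.active u)) (statusPotential (ψ i))
      = ∑ v, I.prob i u v * ψ i v := by
  unfold machineStep
  rw [if_neg hi]
  simp only [if_neg hm]
  rw [expect_map]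
  rfl

theorem expect_machineStep_wait (ψ : ∀ i, S i → ℝ) {σ : Config S} {a : Decision n} {i : Fin n}
    (hi : i ∉ a.serve) (hq : InQueue σ a i) :
    expect (I.machineStep a i (σ i)) (statusPotential (ψ i)) = 0 := by
  unfold machineStep
  rw [if_neg hi]
  rcases hσ : σ i with u | _ | _
  · have hm : i ∈ a.move := by simpa [InQueue, hσ] using hq
    simp only [if_pos hm, expect_pure, statusPotential]
  · simp only [expect_pure, statusPotential]
  · simp only [expect_pure, statusPotential]

/-- A feasible decision earns at most the dual objective, up to the change of the potential given
by a dual solution. -/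
theorem reward_add_expect_le {D : DualVars S} (hD : I.DualFeasible D) {σ : Config S}
    {a : Decision n} (ha : I.Feasible σ a) :
    I.reward σ a + expect (I.step σ a) (potential D.phi)
      ≤ I.dualObjective D + potential D.phi σ := by
  -- The bound decouples over machines; capacity enters only when the `lam` terms are counted.
  have hi : ∀ i, I.machineReward a i (σ i)
      + expect (I.machineStep a i (σ i)) (statusPotential (D.phi i))
      ≤ (D.h i + if i ∈ a.serve then D.lam else 0) + statusPotential (D.phi i) (σ i) := by
    intro i
    have hr := hD.repair i
    have hh := hD.h_nonneg i
    by_cases hs : i ∈ a.serve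
    · rw [expect_machineStep_serve I D.phi hs, if_pos hs]
      have hq := ha.serve_inQueue i hs
      rcases hσ : σ i with u | _ | _
      · have hm : i ∈ a.move := by simpa [InQueue, hσ] using hq
        simp only [machineReward, if_pos hm, statusPotential]
        linarith [hD.move i u]
      · simp only [machineReward, statusPotential]
        linarith
      · simp only [machineReward, statusPotential]
        linarith
    · rw [if_neg hs]
      by_cases hq : InQueue σ a i
      · rw [expect_machineStep_wait I D.phi hs hq]
        rcases hσ : σ i with u | _ | _
        · have hm : i ∈ a.move := by simpa [InQueue, hσ] using hq
          simp only [machineReward, if_pos hm, statusPotential]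
          linarith [hD.move i u]
        · simp only [machineReward, statusPotential]
          linarith
        · simp only [machineReward, statusPotential]
          linarith
      · rcases hσ : σ i with u | _ | _
        · have hm : i ∉ a.move := fun h => hq (Or.inl h)
          rw [expect_machineStep_active I D.phi hs hm]
          simp only [machineReward, if_neg hm, statusPotential]
          have := hD.active i u
          rw [sum_prob_mul_sub] at this
          linarith
        · exact absurd (Or.inr (Or.inl hσ)) hq
        · exact absurd (Or.inr (Or.inr hσ)) hq
  have h := sum_le_sum fun i (_ : i ∈ univ) => hi i
  simp only [sum_add_distrib, sum_ite_mem, univ_inter, sum_const, nsmul_eq_mul] at h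
  rw [expect_step_potential, reward, dualObjective, potential]
  have hcap : (a.serve.card : ℝ) * D.lam ≤ I.M * D.lam :=
    mul_le_mul_of_nonneg_right (by exact_mod_cast ha.capacity) hD.lam_nonneg
  linarith

/-! ### Balanced decisions -/

/-- The statuses of a machine that occur under a balanced policy. -/
def GoodStatus (D : DualVars S) (i : Fin n) (ψ : S i → ℝ) (G : Set (S i)) :
    Status (S i) → Prop
  | .active u => u ∈ G
  | .queued => 0 < D.h i ∧ D.lam + D.h i ≤ I.s i * ψ (I.ρ i) ∧ I.ρ i ∈ G
  | .inRepair => 0 < D.h i ∧ D.lam + D.h i ≤ I.s i * ψ (I.ρ i) ∧ I.ρ i ∈ G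

variable {I}

theorem BalancedDecision.inQueue_facts {D : DualVars S} {P : PrimalVars S} {σ : Config S}
    {a : Decision n} (ha : I.BalancedDecision D P σ a) {i : Fin n} {ψ : S i → ℝ}
    {G : Set (S i)} (hc : I.Certificate D P i ψ G) (hg : I.GoodStatus D i ψ G (σ i))
    (hq : InQueue σ a i) :
    0 < D.h i ∧ D.lam + D.h i ≤ I.s i * ψ (I.ρ i) ∧ I.ρ i ∈ G := by
  rcases hσ : σ i with u | _ | _
  · have hm : i ∈ a.move := by simpa [InQueue, hσ] using hq
    obtain ⟨hi, v, hv, hz⟩ := (ha.move_iff i).1 hm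
    rw [hv] at hg
    exact ⟨hi, hc.repair v hg hi hz, hc.restart v hg hi hz⟩
  · rwa [hσ] at hg
  · rwa [hσ] at hg

theorem BalancedDecision.goodStatus_step {D : DualVars S} {P : PrimalVars S} {σ : Config S}
    {a : Decision n} (ha : I.BalancedDecision D P σ a) {i : Fin n} {ψ : S i → ℝ}
    {G : Set (S i)} (hc : I.Certificate D P i ψ G) (hg : I.GoodStatus D i ψ G (σ i))
    {τ : Status (S i)} (hτ : τ ∈ (I.machineStep a i (σ i)).support) :
    I.GoodStatus D i ψ G τ := by
  unfold machineStep at hτ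
  by_cases hs : i ∈ a.serve
  · rw [if_pos hs, PMF.mem_support_map_iff] at hτ
    obtain ⟨done, -, rfl⟩ := hτ
    have h := ha.inQueue_facts hc hg (ha.feasible.serve_inQueue i hs)
    cases done
    · exact h
    · exact h.2.2
  · rw [if_neg hs] at hτ
    rcases hσ : σ i with u | _ | _
    · simp only [hσ] at hτ
      by_cases hm : i ∈ a.move
      · rw [if_pos hm, PMF.mem_support_pure_iff] at hτ
        rw [hτ]
        exact ha.inQueue_facts hc hg (Or.inl hm)
      · rw [if_neg hm, PMF.mem_support_map_iff] at hτ
        obtain ⟨v, hv, rfl⟩ := hτ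
        rw [hσ] at hg
        exact hc.closed u hg (ha.not_charged hσ hm) v
          (ENNReal.toReal_pos hv ((I.p i u).apply_ne_top v))
    · simp only [hσ, PMF.mem_support_pure_iff] at hτ
      rw [hτ]
      rwa [hσ] at hg
    · simp only [hσ, PMF.mem_support_pure_iff] at hτ
      rw [hτ]
      rwa [hσ] at hg

/-- A balanced decision earns at least half of the dual objective, up to the change of the
potential. -/
theorem BalancedDecision.le_reward_add_expect {D : DualVars S} {P : PrimalVars S}
    (hD : I.DualFeasible D) {σ : Config S} {a : Decision n} (ha : I.BalancedDecision D P σ a)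
    {ψ : ∀ i, S i → ℝ} {G : ∀ i, Set (S i)} (hc : ∀ i, I.Certificate D P i (ψ i) (G i))
    (hg : ∀ i, I.GoodStatus D i (ψ i) (G i) (σ i)) :
    I.M * D.lam + potential ψ σ ≤ I.reward σ a + expect (I.step σ a) (potential ψ) := by
  classical
  -- The guaranteed contribution of each machine when it is worked on, waiting, or active.
  let gain (i : Fin n) : ℝ :=
    if i ∈ a.serve then D.lam + D.h i else if InQueue σ a i then 0 else D.h i
  have hi : ∀ i, gain i + statusPotential (ψ i) (σ i) ≤ I.machineReward a i (σ i)
      + expect (I.machineStep a i (σ i)) (statusPotential (ψ i)) := by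
    intro i
    have hidle : InQueue σ a i →
        statusPotential (ψ i) (σ i) ≤ I.machineReward a i (σ i) := fun hq => by
      have hgi := hg i
      rcases hσ : σ i with u | _ | _
      · have hm : i ∈ a.move := by simpa [InQueue, hσ] using hq
        obtain ⟨hi, v, hv, hz⟩ := (ha.move_iff i).1 hm
        obtain rfl : u = v := by simpa [hσ] using hv
        rw [hσ] at hgi
        simp only [machineReward, if_pos hm, statusPotential]
        exact (hc i).move u hgi hi hz
      · simp only [machineReward, statusPotential, le_refl]
      · simp only [machineReward, statusPotential, le_refl]
    by_cases hs : i ∈ a.serve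
    · have hq := ha.feasible.serve_inQueue i hs
      simp only [gain, if_pos hs, expect_machineStep_serve I ψ hs]
      linarith [hidle hq, (ha.inQueue_facts (hc i) (hg i) hq).2.1]
    · simp only [gain, if_neg hs]
      by_cases hq : InQueue σ a i
      · rw [if_pos hq, expect_machineStep_wait I ψ hs hq]
        linarith [hidle hq]
      · rw [if_neg hq]
        have hm : i ∉ a.move := fun h => hq (Or.inl h)
        have hgi := hg i
        rcases hσ : σ i with u | _ | _
        · rw [hσ] at hgi
          rw [expect_machineStep_active I ψ hs hm]
          simp only [machineReward, if_neg hm, statusPotential]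
          have := (hc i).stay u hgi (ha.not_charged hσ hm)
          rw [sum_prob_mul_sub] at this
          linarith
        · exact absurd (Or.inr (Or.inl hσ)) hq
        · exact absurd (Or.inr (Or.inr hσ)) hq
  have hgain : I.M * D.lam ≤ ∑ i, gain i := by
    have hlam := hD.lam_nonneg
    have hsub : (a.serve : Set (Fin n)) ⊆ {i | InQueue σ a i} :=
      fun i hi => ha.feasible.serve_inQueue i hi
    -- With full capacity in use, the `lam` terms alone give `M * lam`. Otherwise the whole queue is
    -- worked on, every gain is at least `h i`, and balance gives the same total.
    rcases le_total I.M {i | InQueue σ a i}.ncard with hM | hM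
    · have hcard := ha.busy
      rw [min_eq_left hM] at hcard
      calc I.M * D.lam = ∑ i, if i ∈ a.serve then D.lam else 0 := by
            simp [sum_ite_mem, hcard]
        _ ≤ ∑ i, gain i := sum_le_sum fun i _ => by
            have := hD.h_nonneg i
            simp only [gain]
            split_ifs <;> linarith
    · have hcard := ha.busy
      rw [min_eq_right hM] at hcard
      have heq := Set.eq_of_subset_of_ncard_le hsub (by rw [Set.ncard_coe_finset, hcard])
        (Set.toFinite _)
      rw [hD.balance]
      refine sum_le_sum fun i _ => ?_
      have hmem : InQueue σ a i → i ∈ a.serve := fun h => by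
        have : i ∈ (a.serve : Set (Fin n)) := by rw [heq]; exact h
        exact this
      simp only [gain]
      split_ifs with h1 h2
      · linarith
      · exact absurd (hmem h2) h1
      · exact le_rfl
  have h := sum_le_sum fun i (_ : i ∈ univ) => hi i
  simp only [sum_add_distrib] at h
  rw [expect_step_potential, reward, potential]
  linarith

end Model

/-- The history at the beginning of the first slot. -/
def History.start {n : ℕ} {S : Fin n → Type u} (σ : Config S) : History S 0 := σ

/-- The history after one more slot. -/
def History.extend {n : ℕ} {S : Fin n → Type u} {t : ℕ} (h : History S t) (a : Decision n)
    (σ : Config S) : History S (t + 1) := (h, a, σ)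

namespace Model

variable {n : ℕ} {S : Fin n → Type u} [∀ i, Fintype (S i)] {I : Model n S}
  {σ₀ : ∀ i, S i} {π : Policy S}

/-! ### Long-run averages -/

theorem law_zero : I.law σ₀ π 0 = PMF.pure (History.start fun i => .active (σ₀ i)) := rfl

theorem law_succ (t : ℕ) : I.law σ₀ π (t + 1) = (I.law σ₀ π t).bind fun h =>
    (π t h).bind fun a => (I.step h.current a).map (h.extend a) := rfl

theorem law_invariant (Q : Config S → Prop) (h0 : Q fun i => .active (σ₀ i))
    (hstep : ∀ t, ∀ h ∈ (I.law σ₀ π t).support, ∀ a ∈ (π t h).support, Q h.current →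
      ∀ τ ∈ (I.step h.current a).support, Q τ) :
    ∀ t, ∀ h ∈ (I.law σ₀ π t).support, Q h.current
  | 0, h, hh => by
    rw [law_zero, PMF.mem_support_pure_iff] at hh
    rw [hh]
    exact h0
  | t + 1, h, hh => by
    rw [law_succ, PMF.mem_support_bind_iff] at hh
    obtain ⟨h', hh', hh⟩ := hh
    rw [PMF.mem_support_bind_iff] at hh
    obtain ⟨a, ha, hh⟩ := hh
    rw [PMF.mem_support_map_iff] at hh
    obtain ⟨τ, hτ, rfl⟩ := hh
    exact hstep t h' hh' a ha (law_invariant Q h0 hstep t h' hh') τ hτ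

/-- Conditioning on the history and the decision reduces a statement about the law to an inequality
for a single slot. -/
theorem expectedReward_add_expect (F : Config S → ℝ) (t : ℕ) :
    I.expectedReward σ₀ π t + expect (I.law σ₀ π (t + 1)) (fun h => F h.current)
      = expect (I.law σ₀ π t) fun h => expect (π t h) fun a =>
        I.reward h.current a + expect (I.step h.current a) F := by
  have h1 : expect (I.law σ₀ π (t + 1)) (fun h => F h.current)
      = expect (I.law σ₀ π t) fun h => expect (π t h) fun a =>
        expect (I.step h.current a) F := by
    rw [law_succ, expect_bind]
    simp only [expect_bind, expect_map]
    rfl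
  rw [h1]
  simp only [expect_add]
  rfl

theorem sum_expectedReward_le {F : Config S → ℝ} {v : ℝ}
    (hF : ∀ t, ∀ h ∈ (I.law σ₀ π t).support, ∀ a ∈ (π t h).support,
      I.reward h.current a + expect (I.step h.current a) F ≤ v + F h.current) (T : ℕ) :
    ∑ t ∈ range T, I.expectedReward σ₀ π t + expect (I.law σ₀ π T) (fun h => F h.current)
      ≤ T * v + expect (I.law σ₀ π 0) (fun h => F h.current) := by
  induction T with
  | zero => simp
  | succ T ih =>
    have h : I.expectedReward σ₀ π T + expect (I.law σ₀ π (T + 1)) (fun h => F h.current)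
        ≤ v + expect (I.law σ₀ π T) fun h => F h.current := by
      rw [expectedReward_add_expect, ← expect_const (I.law σ₀ π T) v, ← expect_add]
      refine expect_mono _ fun h hh => ?_
      exact (expect_mono _ fun a ha => hF T h hh a ha).trans_eq (expect_const _ _)
    rw [sum_range_succ]
    push_cast
    linarith

theorem le_sum_expectedReward {F : Config S → ℝ} {v : ℝ}
    (hF : ∀ t, ∀ h ∈ (I.law σ₀ π t).support, ∀ a ∈ (π t h).support,
      v + F h.current ≤ I.reward h.current a + expect (I.step h.current a) F) (T : ℕ) :
    T * v + expect (I.law σ₀ π 0) (fun h => F h.current) ≤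
      ∑ t ∈ range T, I.expectedReward σ₀ π t + expect (I.law σ₀ π T) (fun h => F h.current) := by
  induction T with
  | zero => simp
  | succ T ih =>
    have h : v + expect (I.law σ₀ π T) (fun h => F h.current) ≤
        I.expectedReward σ₀ π T + expect (I.law σ₀ π (T + 1)) fun h => F h.current := by
      rw [expectedReward_add_expect, ← expect_const (I.law σ₀ π T) v, ← expect_add]
      refine expect_mono _ fun h hh => ?_
      exact (expect_const _ _).symm.trans_le (expect_mono _ fun a ha => hF T h hh a ha)
    rw [sum_range_succ]
    push_cast
    linarith

theorem exists_abs_expect_le (F : Config S → ℝ) :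
    ∃ B, ∀ T, |expect (I.law σ₀ π T) fun h => F h.current| ≤ B := by
  obtain ⟨B, hB⟩ := Finite.bddAbove_range fun σ => |F σ|
  have hB' : ∀ σ, |F σ| ≤ B := fun σ => hB ⟨σ, rfl⟩
  refine ⟨B, fun T => abs_le.2 ⟨?_, ?_⟩⟩
  · rw [← expect_const (I.law σ₀ π T) (-B)]
    exact expect_mono _ fun h _ => (abs_le.1 (hB' _)).1
  · rw [← expect_const (I.law σ₀ π T) B]
    exact expect_mono _ fun h _ => (abs_le.1 (hB' _)).2

theorem tendsto_add_div_atTop (v C : ℝ) :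
    Tendsto (fun T : ℕ => ((v + C / T : ℝ) : EReal)) atTop (nhds (v : EReal)) := by
  have h := (tendsto_const_nhds (x := v)).add (tendsto_const_div_atTop_nhds_zero_nat C)
  rw [add_zero] at h
  exact (continuous_coe_real_ereal.tendsto v).comp h

/-- The telescoped potential leaves two boundary terms. They are bounded by a common `B`, since
there are finitely many configurations, and vanish after division by `T`. -/
theorem limsup_average_le {F : Config S → ℝ} {v : ℝ}
    (hF : ∀ t, ∀ h ∈ (I.law σ₀ π t).support, ∀ a ∈ (π t h).support,
      I.reward h.current a + expect (I.step h.current a) F ≤ v + F h.current) :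
    limsup (fun T => (I.average σ₀ π T : EReal)) atTop ≤ v := by
  obtain ⟨B, hB⟩ := exists_abs_expect_le (I := I) (σ₀ := σ₀) (π := π) F
  rw [← (tendsto_add_div_atTop v (2 * B)).limsup_eq]
  refine limsup_le_limsup ?_
  filter_upwards [eventually_gt_atTop 0] with T hT
  have hT' : (0 : ℝ) < T := by exact_mod_cast hT
  rw [EReal.coe_le_coe_iff, average, div_le_iff₀ hT', add_mul, div_mul_cancel₀ _ hT'.ne']
  have h1 := sum_expectedReward_le hF T
  linarith [(abs_le.1 (hB T)).1, (abs_le.1 (hB 0)).2]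

theorem le_liminf_average {F : Config S → ℝ} {v : ℝ}
    (hF : ∀ t, ∀ h ∈ (I.law σ₀ π t).support, ∀ a ∈ (π t h).support,
      v + F h.current ≤ I.reward h.current a + expect (I.step h.current a) F) :
    v ≤ liminf (fun T => (I.average σ₀ π T : EReal)) atTop := by
  obtain ⟨B, hB⟩ := exists_abs_expect_le (I := I) (σ₀ := σ₀) (π := π) F
  rw [← (tendsto_add_div_atTop v (-(2 * B))).liminf_eq]
  refine liminf_le_liminf ?_
  filter_upwards [eventually_gt_atTop 0] with T hT
  have hT' : (0 : ℝ) < T := by exact_mod_cast hT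
  rw [EReal.coe_le_coe_iff, average, le_div_iff₀ hT', add_mul, div_mul_cancel₀ _ hT'.ne']
  have h1 := le_sum_expectedReward hF T
  linarith [(abs_le.1 (hB T)).2, (abs_le.1 (hB 0)).1]

variable (I) in
theorem optimalValue_le {D : DualVars S} (hD : I.DualFeasible D) :
    I.optimalValue ≤ I.dualObjective D :=
  iSup_le fun _ => iSup_le fun _ => iSup_le fun hπ => limsup_average_le fun t h hh a ha =>
    I.reward_add_expect_le hD (hπ t h hh a ha)

/-! ### Balanced policies -/

/-- The hypothesis is what reconciles non-preemption with capacity: the set to work on is chosen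
between the started repairs and the whole queue. -/
theorem exists_balancedDecision (D : DualVars S) (P : PrimalVars S) {σ : Config S}
    (hσ : {i | σ i = .inRepair}.ncard ≤ I.M) : ∃ a, I.BalancedDecision D P σ a := by
  classical
  let move : Finset (Fin n) := {i | 0 < D.h i ∧ ∃ u, σ i = .active u ∧ 0 < P.z i u}
  let queue : Finset (Fin n) := {i | i ∈ move ∨ σ i = .queued ∨ σ i = .inRepair}
  let started : Finset (Fin n) := {i | σ i = .inRepair}
  have hsub : started ⊆ queue := fun i hi => by
    simp only [started, queue, mem_filter, mem_univ, true_and] at hi ⊢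
    exact Or.inr (Or.inr hi)
  have hstarted : started.card ≤ I.M := by
    rw [← Set.ncard_coe_finset]
    convert hσ using 2
    ext i
    simp [started]
  obtain ⟨serve, h1, h2, hcard⟩ := exists_subsuperset_card_eq hsub
    (le_min hstarted (card_le_card hsub)) (min_le_right I.M queue.card)
  have hqueue : {i | InQueue σ (move, serve) i} = queue := by
    ext i
    simp [InQueue, queue]
  have hmove : ∀ i, i ∈ move ↔ 0 < D.h i ∧ ∃ u, σ i = .active u ∧ 0 < P.z i u := fun i => by
    simp [move]
  refine ⟨(move, serve), ⟨fun i hi => ?_, fun i hi => ?_, fun i hi => ?_, ?_⟩, hmove, ?_⟩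
  · obtain ⟨-, u, hu, -⟩ := (hmove i).1 hi
    exact ⟨u, hu⟩
  · have : i ∈ {i | InQueue σ (move, serve) i} := by rw [hqueue]; exact h2 hi
    exact this
  · exact h1 (by simpa [started] using hi)
  · exact hcard.trans_le (min_le_left _ _)
  · rw [hqueue, Set.ncard_coe_finset]
    exact hcard

/-- Every repair in progress after a slot was worked on during it, since started repairs are never
interrupted. -/
theorem ncard_inRepair_step_le {σ τ : Config S} {a : Decision n} (ha : I.Feasible σ a)
    (hτ : τ ∈ (I.step σ a).support) : {i | τ i = .inRepair}.ncard ≤ I.M := by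
  refine le_trans ?_ ha.capacity
  rw [← Set.ncard_coe_finset]
  refine Set.ncard_le_ncard (fun i hi => ?_) (Set.toFinite _)
  by_contra hs
  rw [mem_coe] at hs
  have h := mem_support_independent _ hτ i
  rw [Set.mem_ofPred_eq] at hi
  unfold machineStep at h
  rw [hi, if_neg hs] at h
  rcases hσ : σ i with u | _ | _
  · simp only [hσ] at h
    split_ifs at h
    · rw [PMF.mem_support_pure_iff] at h
      cases h
    · rw [PMF.mem_support_map_iff] at h
      obtain ⟨v, -, hv⟩ := h
      cases hv
  · simp only [hσ, PMF.mem_support_pure_iff] at h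
    cases h
  · exact hs (ha.nonpreemptive i hσ)

variable (I σ₀) in
theorem exists_isBalancedPolicy (D : DualVars S) (P : PrimalVars S) :
    ∃ π : Policy S, I.IsBalancedPolicy D P σ₀ π := by
  have hdec : ∀ σ : Config S, ∃ a, {i | σ i = .inRepair}.ncard ≤ I.M →
      I.BalancedDecision D P σ a := fun σ => by
    by_cases hσ : {i | σ i = .inRepair}.ncard ≤ I.M
    · exact (exists_balancedDecision D P hσ).imp fun a ha _ => ha
    -- A dummy decision: configurations with more than `M` started repairs have probability zero.
    · exact ⟨(∅, ∅), fun h => absurd h hσ⟩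
  choose dec hdec using hdec
  have hinv := law_invariant (I := I) (σ₀ := σ₀) (π := fun _ h => PMF.pure (dec h.current))
    (fun σ => {i | σ i = .inRepair}.ncard ≤ I.M) (by simp) (by
      intro t h _ a ha hQ τ hτ
      rw [PMF.mem_support_pure_iff] at ha
      rw [ha] at hτ
      exact ncard_inRepair_step_le (hdec _ hQ).feasible hτ)
  refine ⟨fun _ h => PMF.pure (dec h.current), fun t h hh a ha => ?_⟩
  rw [PMF.mem_support_pure_iff] at ha
  rw [ha]
  exact hdec _ (hinv t h hh)

/-- The certificates hold only on the sets `G`, so good statuses must first be shown invariant along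
the policy; the one-slot bound then applies almost surely. -/
theorem le_guaranteedValue [∀ i, DecidableEq (S i)] {D : DualVars S} {P : PrimalVars S}
    (hD : I.DualOptimal D) (hP : I.PrimalOptimal P) (hσ₀ : I.GoodStart D P σ₀)
    (hπ : I.IsBalancedPolicy D P σ₀ π) :
    ((I.M * D.lam : ℝ) : EReal) ≤ I.guaranteedValue σ₀ π := by
  choose ψ G hc hG using exists_certificate hD hP hσ₀
  have hinv := law_invariant (I := I) (σ₀ := σ₀) (π := π)
    (fun σ => ∀ i, I.GoodStatus D i (ψ i) (G i) (σ i)) hG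
    fun t h hh a ha hg τ hτ i =>
      (hπ t h hh a ha).goodStatus_step (hc i) (hg i) (mem_support_independent _ hτ i)
  exact le_liminf_average fun t h hh a ha =>
    (hπ t h hh a ha).le_reward_add_expect hD.1 hc (hinv t h hh)

end Model

end Replenishment

/-! ### The approximation guarantee -/

theorem mainTheorem4 {n : ℕ} {S : Fin n → Type u} [∀ i, Fintype (S i)]
    [∀ i, DecidableEq (S i)] (I : Replenishment.Model n S) :
    (∃ (D : Replenishment.DualVars S) (P : Replenishment.PrimalVars S),
      I.DualOptimal D ∧ I.PrimalOptimal P) ∧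
    ∀ (D : Replenishment.DualVars S) (P : Replenishment.PrimalVars S),
      I.DualOptimal D → I.PrimalOptimal P →
      (∃ σ₀ : ∀ i, S i, I.GoodStart D P σ₀) ∧
      ∀ σ₀ : ∀ i, S i, I.GoodStart D P σ₀ →
        (∃ π : Replenishment.Policy S, I.IsBalancedPolicy D P σ₀ π) ∧
        ∀ π : Replenishment.Policy S, I.IsBalancedPolicy D P σ₀ π →
          I.Admissible σ₀ π ∧ I.optimalValue ≤ 2 * I.guaranteedValue σ₀ π := by
  refine ⟨?_, fun D P hD hP => ⟨Replenishment.Model.exists_goodStart hD hP, fun σ₀ hσ₀ =>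
    ⟨I.exists_isBalancedPolicy σ₀ D P, fun π hπ =>
      ⟨fun t h hh a ha => (hπ t h hh a ha).feasible, ?_⟩⟩⟩⟩
  · obtain ⟨D, P, hD, hP, -⟩ := I.exists_optimal_pair
    exact ⟨D, P, hD, hP⟩
  -- The factor two of the guarantee is exactly the balance constraint.
  · have hobj : I.dualObjective D = 2 * (I.M * D.lam) := by
      rw [Replenishment.Model.dualObjective, ← hD.1.balance, two_mul]
    calc I.optimalValue ≤ I.dualObjective D := I.optimalValue_le hD.1
      _ = 2 * ((I.M * D.lam : ℝ) : EReal) := by rw [hobj, EReal.coe_mul]; rfl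
      _ ≤ 2 * I.guaranteedValue σ₀ π :=
        mul_le_mul_of_nonneg_left (Replenishment.Model.le_guaranteedValue hD hP hσ₀ hπ) zero_le_two
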